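/- Let $F/\mathbf F_q$ be an algebraic function field of one variable of genus $g$, with distinct places $Q,P_1,\dots,P_n$ of degree one, $D=P_1+\cdots+P_n$, and let $u\ge 0$, $\ell\ge m\ge 0$ be integers. Write $v_Q$ for the valuation at $Q$ and $\mathcal L(\infty Q)=\bigcup_i\mathcal L(iQ)$. Let the Weierstrass semigroup $H(Q)$ be generated by positive integers $a_1,\dots,a_t$, and let $x_1,\dots,x_t\in F$ have pole divisors $(x_i)_\infty=a_iQ$. On $\mathbf N_0^t$ let $M\succ N$ mean that $\sum_i a_iM_i>\sum_i a_iN_i$, or that these sums are equal and $M_i<N_i$ at the first index $i$ where $M,N$ differ. For $0\le j<a_1$ let $b_j=\min\{b\in H(Q): b\equiv j \pmod{a_1}\}$, let $L_j$ be the $\prec$-minimal $M\in\mathbf N_0^t$ with $\sum_i a_iM_i=b_j$, and let $y_j=\prod_{i\ge 2}x_i^{(L_j)_i}$; then $y_0,\dots,y_{a_1-1}$ is a basis of $\mathcal L(\infty Q)$ as an $\mathbf F_q[x_1]$-module. Let $\vec r\in\mathbf F_q^n$, and let $h\in\mathcal L((n+2g-1)Q)$ satisfy $h(P_i)=r_i$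 for all $i$. Assume that there is $f\in\mathcal L(\infty Q)$ with zero divisor $(f)_0=D$, and that $x_1$ has been chosen so that $f\in\mathbf F_q[x_1]$. For $0\le j<a_1$ and $0\le k\le\ell$ put $$g_{1+j+ka_1}=\begin{cases}(Z-h)^k f^{\,m-k}y_j & (k\le m),\\ Z^{k-m}(Z-h)^m y_j & (k>m),\end{cases}$$ regarded as vectors in $\mathbf F_q[x_1]^s$, $s=a_1(\ell+1)$, where $\mathbf e_{1+j+ka_1}$ stands for $y_jZ^k$. Give $x_1^i\,y_jZ^k$ the weight $-i\,v_Q(x_1)-v_Q(y_j)+ku$, and order monomials by weight, ties being broken in favour of the larger index of $\mathbf e$. Algorithm G of Lee and O'Sullivan treats $r=1,\dots,s$ in turn. For each $r$ it repeats the following. Let $i$ be the index of the leading term of the current $g_r$. If $i=r$, go on to the next $r$. Otherwise let $d=\deg g_{r,i}-\deg g_{i,i}$ and $c=\mathrm{lc}(g_{r,i})\,\mathrm{lc}(g_{i,i})^{-1}$, where $g_{r,i}$ is the $i$-th entry of $g_r$ and $\mathrm{lc}$ is the leading coefficient. If $d\ge0$, replace $g_r$ by $g_r-c\,x_1^d g_i$;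 if $d<0$, replace simultaneously $g_i$ by $g_r$ and $g_r$ by $x_1^{-d}g_r-c\,g_i$. Each such replacement is charged one multiplication in $\mathbf F_q$ for $c$, and $\deg p+1$ multiplications for every nonzero entry $p$ of the old $g_i$ in order to form $c\,g_i$ (additions, inversions and shifts by powers of $x_1$ are not multiplications). Then Algorithm G, started on $g_1,\dots,g_s$, terminates, and the number of multiplications is at most $$\Bigl[\max_j\{-v_Q(y_j)\}+m(n+2g-1)+u(\ell-m)\Bigr]^2a_1^{-1}\sum_{i=1}^{a_1(\ell+1)}i^2 .$$ -/

import Mathlib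

open scoped Polynomial

noncomputable section

namespace OnePointAG

/-! ### Algebraic function fields, places, divisors, genus -/

/-- `F / K` is an algebraic function field of one variable: `F` is a finite extension of `K(z)`
for some `z` transcendental over `K`. -/
def IsFunctionField (K F : Type*) [Field K] [Field F] [Algebra K F] : Prop :=
  ∃ z : F, Transcendental K z ∧ FiniteDimensional (IntermediateField.adjoin K {z}) F

/-- A place of `F / K`, given by its normalized discrete valuation `v : F → ℤ ∪ {∞}`,
trivial on the constants `K`. -/
@[ext]
structure Place (K F : Type*) [Field K] [Field F] [Algebra K F] where
  v : AddValuation F (WithTop ℤ)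
  trivial_on_constants : ∀ c : K, c ≠ 0 → v (algebraMap K F c) = 0
  normalized : ∃ z : F, v z = 1

section

variable {K F : Type*} [Field K] [Field F] [Algebra K F]

theorem Place.v_algebraMap_nonneg (P : Place K F) (c : K) : 0 ≤ P.v (algebraMap K F c) := by
  by_cases hc : c = 0
  · simp [hc]
  · exact (P.trivial_on_constants c hc).ge

theorem Place.v_le_smul (P : Place K F) (c : K) (z : F) : P.v z ≤ P.v (c • z) := by
  rw [Algebra.smul_def, P.v.map_mul]
  exact le_add_of_nonneg_left (P.v_algebraMap_nonneg c)

/-- The integer value of the valuation at a nonzero element (it is only used for those). -/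
def Place.ord (P : Place K F) (z : F) : ℤ := (P.v z).untopD 0

/-- The valuation ring `O_P`, as a `K`-subspace of `F`. -/
def Place.valuationRing (P : Place K F) : Submodule K F where
  carrier := {z | 0 ≤ P.v z}
  zero_mem' := by simp
  add_mem' := fun {y z} hy hz => (le_min hy hz).trans (P.v.map_add y z)
  smul_mem' := fun c z hz => le_trans hz (P.v_le_smul c z)

/-- The maximal ideal of `O_P`, as a `K`-subspace of `F`. -/
def Place.maxIdeal (P : Place K F) : Submodule K F where
  carrier := {z | 0 < P.v z}
  zero_mem' := by simp
  add_mem' := fun {y z} hy hz => (lt_min hy hz).trans_le (P.v.map_add y z)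
  smul_mem' := fun c z hz => lt_of_lt_of_le hz (P.v_le_smul c z)

/-- The degree of a place: the dimension over `K` of the residue field. -/
def Place.degree (P : Place K F) : ℕ :=
  Module.finrank K (P.valuationRing ⧸ P.maxIdeal.submoduleOf P.valuationRing)

variable (K F) in
/-- Divisors: finite formal sums of places. -/
abbrev Divisor : Type _ := Place K F →₀ ℤ

/-- The degree of a divisor. -/
def divisorDegree (A : Divisor K F) : ℤ := A.sum fun P k => k * (P.degree : ℤ)

/-- The Riemann-Roch space `L(A)`: all `z` with `v_P(z) ≥ -A(P)` for every place `P`. -/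
def riemannRochSpace (A : Divisor K F) : Submodule K F where
  carrier := {z | ∀ P : Place K F, ((-(A P) : ℤ) : WithTop ℤ) ≤ P.v z}
  zero_mem' := fun P => by simp
  add_mem' := fun {y z} hy hz P => (le_min (hy P) (hz P)).trans (P.v.map_add y z)
  smul_mem' := fun c z hz P => le_trans (hz P) (P.v_le_smul c z)

variable (K F) in
/-- `g` is the genus of `F / K`: the maximum of `deg A - dim L(A) + 1` over all divisors `A`. -/
def IsGenus (g : ℕ) : Prop :=
  IsGreatest {d : ℤ | ∃ A : Divisor K F,
    d = divisorDegree A - (Module.finrank K (riemannRochSpace A) : ℤ) + 1} (g : ℤ)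

/-- `A` is the pole divisor of `z`. -/
def IsPoleDivisor (z : F) (A : Divisor K F) : Prop :=
  z ≠ 0 ∧ ∀ P : Place K F, A P = max (-(P.ord z)) 0

/-- `A` is the zero divisor of `z`. -/
def IsZeroDivisor (z : F) (A : Divisor K F) : Prop :=
  z ≠ 0 ∧ ∀ P : Place K F, A P = max (P.ord z) 0

/-- `L(∞Q)`, the union of all `L(iQ)`: the elements without poles outside `Q`. -/
def regularAwayFrom (Q : Place K F) : Subalgebra K F where
  carrier := {z | ∀ P : Place K F, P ≠ Q → 0 ≤ P.v z}
  mul_mem' := fun {y z} hy hz P hP => by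
    rw [P.v.map_mul]; exact add_nonneg (hy P hP) (hz P hP)
  add_mem' := fun {y z} hy hz P hP => (le_min (hy P hP) (hz P hP)).trans (P.v.map_add y z)
  algebraMap_mem' := fun c P _ => P.v_algebraMap_nonneg c

/-- The Weierstrass semigroup `H(Q)`: the pole orders at `Q` of the nonzero elements of
`L(∞Q)`. -/
def weierstrassSemigroup (Q : Place K F) : Set ℕ :=
  {i | ∃ z ∈ regularAwayFrom Q, z ≠ 0 ∧ Q.ord z = -(i : ℤ)}

end

/-! ### One-point codes and the standard form of `L(∞Q)` -/

/-- The data defining a one-point code together with the generators of `L(∞Q)`: distinct places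
`Q, P_1, …, P_n` of degree one, positive integers `a_1, …, a_{t+1}` that generate `H(Q)`, and
elements `x_i` with pole divisor `a_i Q`.  Indices start at `0`: `a 0` is `a_1`, `x 0` is `x_1`. -/
structure OnePointData (K F : Type*) [Field K] [Field F] [Algebra K F] where
  Q : Place K F
  n : ℕ
  P : Fin n → Place K F
  P_injective : Function.Injective P
  P_ne_Q : ∀ i, P i ≠ Q
  degree_Q : Q.degree = 1
  degree_P : ∀ i, (P i).degree = 1
  t : ℕ
  a : Fin (t + 1) → ℕ
  a_pos : ∀ i, 0 < a i
  a_generate : (AddSubmonoid.closure (Set.range a) : Set ℕ) = weierstrassSemigroup Q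
  x : Fin (t + 1) → F
  x_pole : ∀ i, IsPoleDivisor (x i) (Finsupp.single Q (a i : ℤ))

namespace OnePointData

variable {K F : Type*} [Field K] [Field F] [Algebra K F] (S : OnePointData K F)

/-- `a_1`. -/
abbrev a₁ : ℕ := S.a 0

/-- `x_1`. -/
abbrev x₁ : F := S.x 0

/-- The divisor `D = P_1 + ⋯ + P_n`. -/
def D : Divisor K F := ∑ i, Finsupp.single (S.P i) 1

/-- The weighted degree `∑ a_i M_i` of an exponent vector. -/
def expWeight (M : Fin (S.t + 1) → ℕ) : ℕ := ∑ i, S.a i * M i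

/-- The weighted reverse lexicographic monomial order: `M ≻ N`. -/
def MonomialGT (M N : Fin (S.t + 1) → ℕ) : Prop :=
  S.expWeight N < S.expWeight M ∨
    (S.expWeight M = S.expWeight N ∧ ∃ i, (∀ j, j < i → M j = N j) ∧ M i < N i)

/-- `b_i`, the smallest element of `H(Q)` congruent to `i` modulo `a_1`. -/
def b (i : Fin S.a₁) : ℕ := sInf {k | k ∈ weierstrassSemigroup S.Q ∧ k ≡ i [MOD S.a₁]}

/-- `M` is the `≺`-minimal exponent vector of weight `b_i`. -/
def IsMinimalExponent (i : Fin S.a₁) (M : Fin (S.t + 1) → ℕ) : Prop :=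
  S.expWeight M = S.b i ∧ ∀ N, S.expWeight N = S.b i → N ≠ M → S.MonomialGT N M

open Classical in
/-- `L_i`, the `≺`-minimal exponent vector of weight `b_i`. -/
def L (i : Fin S.a₁) : Fin (S.t + 1) → ℕ :=
  if h : ∃ M, S.IsMinimalExponent i M then h.choose else 0

/-- `y_i`, the product of the powers `x_j ^ (L_i)_j` over all generators other than `x_1`. -/
def y (i : Fin S.a₁) : F := ∏ j : Fin S.t, S.x j.succ ^ S.L i j.succ

open Classical in
/-- The coordinates of `z ∈ L(∞Q)` over `K[x_1]` with respect to the module basis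
`y_0, …, y_{a_1 - 1}`. -/
def coord (z : F) : Fin S.a₁ → K[X] :=
  if h : ∃ c : Fin S.a₁ → K[X], z = ∑ j, Polynomial.aeval S.x₁ (c j) * S.y j then h.choose else 0

/-- The generator, of `Z`-degree `k`, attached to `k` and `j`, where `η_{i,j} = f ^ i y_j`:
it is `(Z - h)^k f^(m-k) y_j` if `k ≤ m`, and `Z^(k-m) (Z - h)^m y_j` if `m < k`. -/
def generator (f h : F) (m k : ℕ) (j : Fin S.a₁) : F[X] :=
  if k ≤ m then
    (Polynomial.X - Polynomial.C h) ^ k * Polynomial.C (f ^ (m - k) * S.y j)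
  else
    Polynomial.X ^ (k - m) * (Polynomial.X - Polynomial.C h) ^ m * Polynomial.C (S.y j)

/-- The generators as vectors in `K[x_1]^(a_1(ℓ+1))`.  The index `i = j + k a_1` stands for
`y_j Z^k`; here `i.divNat = k` and `i.modNat = j`. -/
def generatorVectors (f h : F) (m ℓ : ℕ) :
    Fin ((ℓ + 1) * S.a₁) → Fin ((ℓ + 1) * S.a₁) → K[X] :=
  fun i i' => S.coord ((S.generator f h m i.divNat i.modNat).coeff i'.divNat) i'.modNat

/-- The weight `-v_Q(y_j) + k u` of the module basis element `y_j Z^k`. -/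
def basisWeight (u ℓ : ℕ) : Fin ((ℓ + 1) * S.a₁) → ℤ :=
  fun i => -(S.Q.ord (S.y i.modNat)) + (i.divNat : ℕ) * u

end OnePointData

/-! ### Algorithm G of Lee and O'Sullivan -/

namespace AlgorithmG

variable {K : Type*} [Field K] {s : ℕ}

/-- The position of the leading monomial of the `i`-th entry of `v ∈ K[X]^s` in the monomial
order that compares weights first (`X` has weight `ux` and `e_i` has weight `w i`), then indices. -/
def key (ux : ℤ) (w : Fin s → ℤ) (v : Fin s → K[X]) (i : Fin s) : ℤ ×ₗ Fin s :=
  toLex ((v i).natDegree * ux + w i, i)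

/-- The leading term of `v` lies in the `i`-th entry. -/
def IsLeadIndex (ux : ℤ) (w : Fin s → ℤ) (v : Fin s → K[X]) (i : Fin s) : Prop :=
  v i ≠ 0 ∧ ∀ j, v j ≠ 0 → key ux w v j ≤ key ux w v i

open Classical in
/-- The index of the leading term of `v`; there is none if `v = 0`. -/
def leadIndex (ux : ℤ) (w : Fin s → ℤ) (v : Fin s → K[X]) : Option (Fin s) :=
  if h : ∃ i, IsLeadIndex ux w v i then some h.choose else none

open Classical in
/-- The number of coefficients in a dense representation of `v`: each nonzero entry `p` has
`natDegree p + 1` of them. -/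
def denseSize (v : Fin s → K[X]) : ℕ :=
  ∑ j, if v j = 0 then 0 else (v j).natDegree + 1

variable (K s) in
/-- A state: the number of rows already processed (so that `row` is the index, counted from `0`,
of the current row), the current vectors, and the number of multiplications in `K` so far. -/
structure State where
  row : ℕ
  g : Fin s → Fin s → K[X]
  mults : ℕ

/-- One pass of the loop.  Let `i` be the index of the leading term of the current vector `g_r`.
If `i = r`, pass to the next row.  Otherwise put `d = deg g_{r,i} - deg g_{i,i}` and
`c = lc(g_{r,i}) lc(g_{i,i})⁻¹`.  If `d ≥ 0`, replace `g_r` by `g_r - c X^d g_i`; if `d < 0`,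
replace simultaneously `g_i` by `g_r` and `g_r` by `X^(-d) g_r - c g_i`.  Either way this takes
one multiplication for `c`, and one for each coefficient of `g_i` to form `c g_i`; multiplying by
a power of `X` only shifts coefficients. -/
def step (ux : ℤ) (w : Fin s → ℤ) (σ : State K s) : State K s :=
  if hr : σ.row < s then
    let r : Fin s := ⟨σ.row, hr⟩
    match leadIndex ux w (σ.g r) with
    | none => { σ with row := σ.row + 1 }
    | some i =>
      if i = r then { σ with row := σ.row + 1 }
      else
        let p := σ.g r i
        let q := σ.g i i
        let c : K := p.leadingCoeff * q.leadingCoeff⁻¹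
        let cost := 1 + denseSize (σ.g i)
        if q.natDegree ≤ p.natDegree then
          { row := σ.row
            g := Function.update σ.g r
              (σ.g r - (Polynomial.C c * Polynomial.X ^ (p.natDegree - q.natDegree)) • σ.g i)
            mults := σ.mults + cost }
        else
          { row := σ.row
            g := Function.update (Function.update σ.g i (σ.g r)) r
              ((Polynomial.X ^ (q.natDegree - p.natDegree) : K[X]) • σ.g r
                - (Polynomial.C c : K[X]) • σ.g i)
            mults := σ.mults + cost }
  else σ

/-- The state after `k` passes of the loop on the input vectors `g`. -/
def run (ux : ℤ) (w : Fin s → ℤ) (g : Fin s → Fin s → K[X]) (k : ℕ) : State K s :=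
  (step ux w)^[k] { row := 0, g := g, mults := 0 }

/-- Started on the input vectors `g`, the algorithm terminates (all rows are processed) after
exactly `N` multiplications in `K`. -/
def HaltsWithMultiplications (ux : ℤ) (w : Fin s → ℤ) (g : Fin s → Fin s → K[X]) (N : ℕ) : Prop :=
  ∃ k, s ≤ (run ux w g k).row ∧ (run ux w g k).mults = N

end AlgorithmG

end OnePointAG

end

/-! While row `ρ` is treated, the earlier vectors keep their leading terms on the diagonal, the
later ones are untouched, and each replacement multiplies the determinant by a nonzero constant. The
running time is governed by the `excess`: the weight of the leading term of `g ρ` plus `a₁` times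
the diagonal degrees of the earlier rows, normalized by the input.

A replacement with pivot `i` turns `deg g i i` into the minimum of `deg g i i` and `deg g ρ i`, and
puts the new leading term of `g ρ` below the one formed with their maximum. As minimum plus maximum
equals the sum, the pair (excess, leading index) falls lexicographically (`RowInv.excess_reduce`).
The fixed degree of the determinant keeps the excess positive as long as the leading index is not
`ρ` (`RowInv.excess_pos`): some Leibniz term reaches this degree, and its entries weigh no more than
the leading terms of their rows. When row `ρ`, of `Z`-degree `k`, is begun, the excess is at most `Δ
= min k m * (H - u)` with `H = n + 2g - 1` and truncated subtraction (`RowStart.excess_le`,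
`InputWeights.entry_le`). In particular nothing happens if `u ≥ H`.

Leading indices with the same excess have weights congruent modulo `a₁`. Since `b j ≡ j`, they have
different `Z`-degrees, so one value of the excess allows at most `⌈ρ / a₁⌉` replacements
(`row_cost_le_of_residues`). Together with a uniform degree bound for the entries this suffices if
`a₁ ≥ 2`. For `a₁ = 1` it is too weak; there each pivot is charged by its own diagonal weight, and
the sum of these weights is again controlled by the determinant (`row_cost_le_of_weights`).

The facts needed about the function field follow from the genus inequality `deg A - dim L(A) + 1 ≤
g` alone: `H(Q)` meets every residue class, the `y j` form a basis with pole orders `b j`, and `f`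
has at most `n` poles. -/

namespace OnePointAG.AlgorithmG

open Polynomial

variable {K : Type*} [Field K] {s : ℕ}

/-! ### Leading terms in the weighted order. -/

section LeadIndex

variable {ux : ℤ} {w : Fin s → ℤ}

theorem IsLeadIndex.unique {v : Fin s → K[X]} {i j : Fin s} (hi : IsLeadIndex ux w v i)
    (hj : IsLeadIndex ux w v j) : i = j := by
  have h := le_antisymm (hi.2 j hj.1) (hj.2 i hi.1)
  simp only [key, EmbeddingLike.apply_eq_iff_eq, Prod.mk.injEq] at h
  exact h.2.symm

theorem exists_isLeadIndex (ux : ℤ) (w : Fin s → ℤ) {v : Fin s → K[X]} (hv : v ≠ 0) :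
    ∃ i, IsLeadIndex ux w v i := by
  classical
  obtain ⟨j, hj⟩ := Function.ne_iff.mp hv
  obtain ⟨i, hi, hmax⟩ := (Finset.univ.filter fun i => v i ≠ 0).exists_max_image (key ux w v)
    ⟨j, by simpa using hj⟩
  exact ⟨i, by simpa using hi, fun k hk => hmax k (by simpa using hk)⟩

theorem IsLeadIndex.leadIndex_eq {v : Fin s → K[X]} {i : Fin s} (hi : IsLeadIndex ux w v i) :
    leadIndex ux w v = some i := by
  have h : ∃ i, IsLeadIndex ux w v i := ⟨i, hi⟩
  rw [leadIndex, dif_pos h, h.choose_spec.unique hi]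

theorem key_le_key_iff {v v' : Fin s → K[X]} {i j : Fin s} :
    key ux w v i ≤ key ux w v' j ↔
      (v i).natDegree * ux + w i < (v' j).natDegree * ux + w j ∨
      (v i).natDegree * ux + w i = (v' j).natDegree * ux + w j ∧ i ≤ j := by
  simp [key, Prod.Lex.toLex_le_toLex]

theorem IsLeadIndex.weight_le {v : Fin s → K[X]} {i j : Fin s} (hi : IsLeadIndex ux w v i)
    (hj : v j ≠ 0) : (v j).natDegree * ux + w j ≤ (v i).natDegree * ux + w i := by
  rcases key_le_key_iff.mp (hi.2 j hj) with h | h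
  exacts [h.le, h.1.le]

theorem IsLeadIndex.weight_lt {v : Fin s → K[X]} {i j : Fin s} (hi : IsLeadIndex ux w v i)
    (hj : v j ≠ 0) (hij : i < j) :
    (v j).natDegree * ux + w j < (v i).natDegree * ux + w i := by
  rcases key_le_key_iff.mp (hi.2 j hj) with h | h
  exacts [h, absurd h.2 hij.not_ge]

end LeadIndex

/-! ### A single replacement: determinant and leading term. -/

section Reduction

/-- The vector that replaces `g_r` when its leading term is cancelled against that of `g_i`. -/
noncomputable def cancelLead (g : Fin s → Fin s → K[X]) (r i : Fin s) : Fin s → K[X] :=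
  (X ^ ((g i i).natDegree - (g r i).natDegree) : K[X]) • g r
    - (C ((g r i).leadingCoeff * (g i i).leadingCoeff⁻¹)
        * X ^ ((g r i).natDegree - (g i i).natDegree)) • g i

/-- The vectors after `g_r` has been reduced by `g_i`. -/
noncomputable def reduceRows (g : Fin s → Fin s → K[X]) (r i : Fin s) : Fin s → Fin s → K[X] :=
  if (g i i).natDegree ≤ (g r i).natDegree then Function.update g r (cancelLead g r i)
  else Function.update (Function.update g i (g r)) r (cancelLead g r i)

variable {ux : ℤ} {w : Fin s → ℤ}

theorem step_of_lead_self {σ : State K s} (hr : σ.row < s)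
    (h : IsLeadIndex ux w (σ.g ⟨σ.row, hr⟩) ⟨σ.row, hr⟩) :
    step ux w σ = { σ with row := σ.row + 1 } := by
  simp [step, hr, h.leadIndex_eq]

theorem step_of_lead_ne {σ : State K s} {i r : Fin s} (hr : σ.row = r)
    (h : IsLeadIndex ux w (σ.g r) i) (hi : i ≠ r) :
    step ux w σ = { row := σ.row, g := reduceRows σ.g r i,
                    mults := σ.mults + (1 + denseSize (σ.g i)) } := by
  have hr' : σ.row < s := hr ▸ r.2
  obtain rfl : r = ⟨σ.row, hr'⟩ := Fin.ext hr.symm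
  simp only [step, hr', h.leadIndex_eq, if_neg hi, dite_true, reduceRows]
  split_ifs with hd
  · congr 2
    rw [cancelLead, Nat.sub_eq_zero_of_le hd]
    simp
  · congr 2
    rw [cancelLead, Nat.sub_eq_zero_of_le (not_le.mp hd).le]
    simp

theorem reduceRows_self (g : Fin s → Fin s → K[X]) (r i : Fin s) :
    reduceRows g r i r = cancelLead g r i := by
  unfold reduceRows; split_ifs <;> simp

theorem reduceRows_of_ne (g : Fin s → Fin s → K[X]) {r i t : Fin s} (hr : t ≠ r) (hi : t ≠ i) :
    reduceRows g r i t = g t := by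
  unfold reduceRows; split_ifs <;> simp [hr, hi]

theorem reduceRows_of_le (g : Fin s → Fin s → K[X]) {r i : Fin s} (hi : i ≠ r)
    (h : (g i i).natDegree ≤ (g r i).natDegree) : reduceRows g r i i = g i := by
  simp [reduceRows, h, hi]

theorem reduceRows_of_lt (g : Fin s → Fin s → K[X]) {r i : Fin s} (hi : i ≠ r)
    (h : (g r i).natDegree < (g i i).natDegree) : reduceRows g r i i = g r := by
  simp [reduceRows, h.not_ge, hi]

theorem natDegree_reduceRows (g : Fin s → Fin s → K[X]) {r i : Fin s} (hi : i ≠ r) :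
    (reduceRows g r i i i).natDegree = min (g i i).natDegree (g r i).natDegree := by
  rcases le_or_gt (g i i).natDegree (g r i).natDegree with h | h
  · rw [reduceRows_of_le g hi h, min_eq_left h]
  · rw [reduceRows_of_lt g hi h, min_eq_right h.le]

/-- If `d ≥ 0` this is an elementary row operation. If `d < 0`, the new row `r` is a sum: its `g r`
part is a multiple of the new row `i` and contributes nothing, its `g i` part gives the swapped
matrix, and the sign of the swap cancels that of `-c`. -/
theorem det_reduceRows (g : Fin s → Fin s → K[X]) {r i : Fin s} (hi : i ≠ r)
    (hg : g i i ≠ 0) (hr : g r i ≠ 0) :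
    ∃ c : K, c ≠ 0 ∧ Matrix.det (Matrix.of (reduceRows g r i)) = C c * Matrix.det (Matrix.of g) := by
  have hc : (g r i).leadingCoeff * (g i i).leadingCoeff⁻¹ ≠ 0 :=
    mul_ne_zero (leadingCoeff_ne_zero.mpr hr) (inv_ne_zero (leadingCoeff_ne_zero.mpr hg))
  rcases le_or_gt (g i i).natDegree (g r i).natDegree with h | h
  · refine ⟨1, one_ne_zero, ?_⟩
    have : Matrix.of (reduceRows g r i) = (Matrix.of g).updateRow r
        ((Matrix.of g) r + (-(C ((g r i).leadingCoeff * (g i i).leadingCoeff⁻¹)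
        * X ^ ((g r i).natDegree - (g i i).natDegree))) • (Matrix.of g) i) := by
      rw [reduceRows, if_pos h, cancelLead, Nat.sub_eq_zero_of_le h, pow_zero, one_smul,
        sub_eq_add_neg, ← neg_smul]
      rfl
    rw [this, Matrix.det_updateRow_add_smul_self _ hi.symm]
    simp
  · refine ⟨_, hc, ?_⟩
    set c := (g r i).leadingCoeff * (g i i).leadingCoeff⁻¹ with hcdef
    set e := (g i i).natDegree - (g r i).natDegree
    have h1 : Matrix.of (reduceRows g r i) = (((Matrix.of g).updateRow i (g r)).updateRow r
        ((X ^ e : K[X]) • g r + (-C c) • g i)) := by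
      rw [reduceRows, if_neg h.not_ge, cancelLead, Nat.sub_eq_zero_of_le h.le, pow_zero, mul_one,
        sub_eq_add_neg, ← neg_smul]
      rfl
    have h2 : ((Matrix.of g).updateRow i (g r)).updateRow r (g i)
        = (Matrix.of g).submatrix (Equiv.swap i r) id := by
      ext a b
      rcases eq_or_ne a r with rfl | har
      · simp
      · rcases eq_or_ne a i with rfl | hai
        · simp [har]
        · simp [har, hai, Equiv.swap_apply_of_ne_of_ne]
    have h3 : (((Matrix.of g).updateRow i (g r)).updateRow r (g r)).det = 0 := by
      apply Matrix.det_zero_of_row_eq hi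
      simp [hi]
    rw [h1, Matrix.det_updateRow_add, Matrix.det_updateRow_smul, Matrix.det_updateRow_smul, h2, h3,
      Matrix.det_permute]
    simp [Equiv.Perm.sign_swap hi]

/-- The shifts bring both leading terms to index `i` and to the larger degree, with equal
coefficients. Their difference loses degree at `i`, and all other entries were already below. -/
theorem cancelLead_key_lt (hux : 0 < ux) (g : Fin s → Fin s → K[X]) {r i : Fin s}
    (hr : IsLeadIndex ux w (g r) i) (hi : IsLeadIndex ux w (g i) i) {j : Fin s}
    (hj : cancelLead g r i j ≠ 0) :
    key ux w (cancelLead g r i) j <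
      toLex (((max (g i i).natDegree (g r i).natDegree : ℕ) : ℤ) * ux + w i, i) := by
  set p := (g r i).natDegree with hp
  set q := (g i i).natDegree with hq
  set c := (g r i).leadingCoeff * (g i i).leadingCoeff⁻¹ with hc
  have hN : cancelLead g r i j = X ^ (q - p) * g r j - C c * X ^ (p - q) * g i j := by
    simp [cancelLead, hp, hq, hc]
  have hmax1 : q - p + p = max q p := by omega
  have hmax2 : p - q + q = max q p := by omega
  have hA : (X ^ (q - p) * g r j).natDegree ≤ q - p + (g r j).natDegree :=
    natDegree_mul_le.trans (by simp)
  have hB : (C c * X ^ (p - q) * g i j).natDegree ≤ p - q + (g i j).natDegree := by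
    refine natDegree_mul_le.trans ?_
    gcongr
    exact (natDegree_C_mul_le _ _).trans (by simp)
  have hle : (cancelLead g r i j).natDegree ≤
      max (X ^ (q - p) * g r j).natDegree (C c * X ^ (p - q) * g i j).natDegree := by
    rw [hN]; exact natDegree_sub_le _ _
  rw [key, Prod.Lex.toLex_lt_toLex]
  simp only
  rcases eq_or_ne j i with rfl | hji
  · left
    have hlt : (cancelLead g r j j).natDegree < max q p := by
      have hdeg : (cancelLead g r j j).degree < (X ^ (q - p) * g r j).degree := by
        rw [hN]
        refine degree_sub_lt_left ?_ ?_ ?_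
        · have hc0 : c ≠ 0 := mul_ne_zero (leadingCoeff_ne_zero.mpr hr.1)
            (inv_ne_zero (leadingCoeff_ne_zero.mpr hi.1))
          rw [degree_mul, degree_mul, degree_mul, degree_C hc0, degree_X_pow, degree_X_pow,
            degree_eq_natDegree hr.1, degree_eq_natDegree hi.1, zero_add]
          norm_cast
          omega
        · exact mul_ne_zero (pow_ne_zero _ X_ne_zero) hr.1
        · rw [leadingCoeff_mul, leadingCoeff_mul, leadingCoeff_mul, leadingCoeff_X_pow,
            leadingCoeff_X_pow, leadingCoeff_C, hc, one_mul, mul_one, mul_assoc,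
            inv_mul_cancel₀ (leadingCoeff_ne_zero.mpr hi.1), mul_one]
      have := natDegree_lt_natDegree hj hdeg
      omega
    have : ((cancelLead g r j j).natDegree : ℤ) < ((max q p : ℕ) : ℤ) := by exact_mod_cast hlt
    nlinarith
  -- Off index `i` no cancellation is needed: one of the two shifted vectors bounds the degree, and
  -- its own leading term bounds the key.
  · have key1 : ∀ (v : Fin s → K[X]) (e : ℕ), IsLeadIndex ux w v i → e + (v i).natDegree = max q p →
        v j ≠ 0 → (cancelLead g r i j).natDegree ≤ e + (v j).natDegree →
        ((cancelLead g r i j).natDegree : ℤ) * ux + w j < ((max q p : ℕ) : ℤ) * ux + w i ∨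
        ((cancelLead g r i j).natDegree : ℤ) * ux + w j = ((max q p : ℕ) : ℤ) * ux + w i ∧ j < i := by
      intro v e hv he hvj hd
      have hd' : ((cancelLead g r i j).natDegree : ℤ) ≤ e + (v j).natDegree := by exact_mod_cast hd
      have he' : ((max q p : ℕ) : ℤ) = e + (v i).natDegree := by exact_mod_cast he.symm
      rw [he']
      have h4 : ((cancelLead g r i j).natDegree : ℤ) * ux ≤ (e + (v j).natDegree) * ux :=
        mul_le_mul_of_nonneg_right hd' hux.le
      rcases lt_or_gt_of_ne hji with hlt | hgt
      · have := hv.weight_le hvj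
        rcases lt_or_eq_of_le (show ((cancelLead g r i j).natDegree : ℤ) * ux + w j
          ≤ (e + (v i).natDegree) * ux + w i by linarith) with h5 | h5
        exacts [Or.inl h5, Or.inr ⟨h5, hlt⟩]
      · have := hv.weight_lt hvj hgt
        left; linarith
    have hcase : (g r j ≠ 0 ∧ (cancelLead g r i j).natDegree ≤ q - p + (g r j).natDegree) ∨
        (g i j ≠ 0 ∧ (cancelLead g r i j).natDegree ≤ p - q + (g i j).natDegree) := by
      by_cases h1 : g r j = 0
      · right
        have h2 : g i j ≠ 0 := by
          intro h2; apply hj; rw [hN, h1, h2]; simp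
        refine ⟨h2, ?_⟩
        rw [h1] at hle; simp only [mul_zero, natDegree_zero, zero_le, sup_of_le_right] at hle
        exact hle.trans hB
      · by_cases h2 : g i j = 0
        · left
          refine ⟨h1, ?_⟩
          rw [h2] at hle; simp only [mul_zero, natDegree_zero, zero_le, sup_of_le_left] at hle
          exact hle.trans hA
        · rcases le_max_iff.mp hle with h | h
          exacts [Or.inl ⟨h1, h.trans hA⟩, Or.inr ⟨h2, h.trans hB⟩]
    rcases hcase with ⟨h1, h2⟩ | ⟨h1, h2⟩
    exacts [key1 _ _ hr hmax1 h1 h2, key1 _ _ hi hmax2 h1 h2]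

end Reduction

/-! ### Permutations and the degree of a determinant. -/

section Determinant

/-- Pigeonhole: the `r + 1` indices up to `r` do not inject into the `r` indices below it. -/
theorem Perm.le_apply_of_forall_lt (σ : Equiv.Perm (Fin s)) {r : Fin s}
    (h : ∀ t < r, σ t < r) : r ≤ σ r := by
  by_contra! hr
  have hsub : (Finset.Iic r).image σ ⊆ Finset.Iio r := by
    intro x hx
    obtain ⟨t, ht, rfl⟩ := Finset.mem_image.mp hx
    rcases (Finset.mem_Iic.mp ht).lt_or_eq with h1 | rfl
    exacts [Finset.mem_Iio.mpr (h t h1), Finset.mem_Iio.mpr hr]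
  have := Finset.card_le_card hsub
  rw [Finset.card_image_of_injective _ σ.injective, Fin.card_Iic, Fin.card_Iio] at this
  omega

theorem Perm.eq_one_of_forall_le (σ : Equiv.Perm (Fin s)) (h : ∀ r, σ r ≤ r) : σ = 1 := by
  ext1 r
  exact le_antisymm (h r) (Perm.le_apply_of_forall_lt σ fun t ht => (h t).trans_lt ht)

/-- The leading coefficient of the determinant is nonzero, so some Leibniz term contributes to it.
-/
theorem exists_perm_natDegree_det_le (g : Fin s → Fin s → K[X])
    (h : Matrix.det (Matrix.of g) ≠ 0) :
    ∃ σ : Equiv.Perm (Fin s), (∀ r, g r (σ r) ≠ 0) ∧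
      (Matrix.det (Matrix.of g)).natDegree ≤ ∑ r, (g r (σ r)).natDegree := by
  have hc : (Matrix.det (Matrix.of g)).coeff (Matrix.det (Matrix.of g)).natDegree ≠ 0 := by
    simpa using h
  set N := (Matrix.det (Matrix.of g)).natDegree
  rw [← Matrix.det_transpose, Matrix.det_apply, finsetSum_coeff] at hc
  obtain ⟨σ, -, hσ⟩ := Finset.exists_ne_zero_of_sum_ne_zero hc
  have hσ' : (∏ r, g r (σ r)).coeff N ≠ 0 := by
    intro h0; apply hσ
    rcases Int.units_eq_one_or (Equiv.Perm.sign σ) with h1 | h1 <;> simp [h1, h0]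
  have hne : ∏ r, g r (σ r) ≠ 0 := by rintro h0; simp [h0] at hσ'
  refine ⟨σ, fun r => Finset.prod_ne_zero_iff.mp hne r (Finset.mem_univ r), ?_⟩
  rw [← natDegree_prod _ _ fun r _ => Finset.prod_ne_zero_iff.mp hne r (Finset.mem_univ r)]
  exact le_natDegree_of_ne_zero hσ'

/-- In the degree of the diagonal product only the identity contributes to the Leibniz sum. -/
theorem sum_natDegree_le_natDegree_det (g : Fin s → Fin s → K[X]) (hd : ∀ r, g r r ≠ 0)
    (h : ∀ σ : Equiv.Perm (Fin s), σ ≠ 1 → (∀ r, g r (σ r) ≠ 0) →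
      ∑ r, (g r (σ r)).natDegree < ∑ r, (g r r).natDegree) :
    ∑ r, (g r r).natDegree ≤ (Matrix.det (Matrix.of g)).natDegree := by
  apply le_natDegree_of_ne_zero
  rw [← Matrix.det_transpose, Matrix.det_apply, finsetSum_coeff,
    Finset.sum_eq_single_of_mem 1 (Finset.mem_univ _)]
  · rw [← natDegree_prod _ _ fun r _ => hd r]
    simp only [Equiv.Perm.sign_one, Equiv.Perm.coe_one, id, Matrix.transpose_apply, one_smul,
      Matrix.of_apply, coeff_natDegree]
    exact leadingCoeff_ne_zero.mpr (Finset.prod_ne_zero_iff.mpr fun r _ => hd r)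
  · intro σ _ hσ
    have h0 : (∏ r, g r (σ r)).coeff (∑ r, (g r r).natDegree) = 0 := by
      by_cases hz : ∀ r, g r (σ r) ≠ 0
      · apply coeff_eq_zero_of_natDegree_lt
        rw [natDegree_prod _ _ fun r _ => hz r]
        exact h σ hσ hz
      · push Not at hz
        obtain ⟨r, hr⟩ := hz
        rw [Finset.prod_eq_zero (Finset.mem_univ r) hr, coeff_zero]
    rcases Int.units_eq_one_or (Equiv.Perm.sign σ) with h1 | h1 <;> simp [h1, h0]

end Determinant

/-! ### The invariant of a row and the excess. -/

section RowInvariant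

/-- The vectors `g` may occur while row `ρ` of the lower triangular input `g₀` is processed: the
earlier rows have their leading terms on the diagonal, the later rows are untouched, the
determinant has kept its degree, and all weights in the rows up to `ρ` are at most `M`. -/
structure RowInv (ux : ℤ) (w : Fin s → ℤ) (g₀ : Fin s → Fin s → K[X]) (M : ℤ) (ρ : Fin s)
    (g : Fin s → Fin s → K[X]) : Prop where
  lead : ∀ t < ρ, IsLeadIndex ux w (g t) t
  supp : ∀ t ≤ ρ, ∀ j, ρ < j → g t j = 0
  later : ∀ t, ρ < t → g t = g₀ t
  lower : ∀ t j, t < j → g₀ t j = 0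
  det_ne : Matrix.det (Matrix.of g) ≠ 0
  det_deg : (Matrix.det (Matrix.of g)).natDegree = ∑ t, (g₀ t t).natDegree
  bound : ∀ t ≤ ρ, ∀ j, g t j ≠ 0 → ((g t j).natDegree : ℤ) * ux + w j ≤ M

/-- The weight of the leading term of `g_ρ` together with the diagonal degrees of the earlier rows,
measured from the value reached when row `ρ` is finished. -/
def excess (ux : ℤ) (w : Fin s → ℤ) (g₀ : Fin s → Fin s → K[X]) (ρ : Fin s)
    (g : Fin s → Fin s → K[X]) (i : Fin s) : ℤ :=
  ((g ρ i).natDegree * ux + w i + ux * ∑ t ∈ Finset.Iio ρ, ((g t t).natDegree : ℤ))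
    - (w ρ + ux * ∑ t ∈ Finset.Iic ρ, ((g₀ t t).natDegree : ℤ))

theorem sum_Iic_eq {A : Type*} [AddCommMonoid A] (f : Fin s → A) (ρ : Fin s) :
    ∑ t ∈ Finset.Iic ρ, f t = ∑ t ∈ Finset.Iio ρ, f t + f ρ := by
  rw [← Finset.Iio_insert, Finset.sum_insert (by simp), add_comm]

theorem sum_univ_eq {A : Type*} [AddCommMonoid A] (f : Fin s → A) (ρ : Fin s) :
    ∑ t, f t = ∑ t ∈ Finset.Iic ρ, f t + ∑ t ∈ Finset.Ioi ρ, f t := by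
  rw [← Finset.sum_union]
  · congr 1
    ext t
    simp [le_or_gt]
  · exact Finset.disjoint_left.mpr fun t h1 h2 =>
      (Finset.mem_Iic.mp h1).not_gt (Finset.mem_Ioi.mp h2)

variable {ux : ℤ} {w : Fin s → ℤ} {g₀ g : Fin s → Fin s → K[X]} {M : ℤ} {ρ i : Fin s}

theorem RowInv.row_ne_zero (h : RowInv ux w g₀ M ρ g) (t : Fin s) : g t ≠ 0 := fun h0 =>
  h.det_ne (Matrix.det_eq_zero_of_row_eq_zero t fun j => congrFun h0 j)

theorem RowInv.exists_lead (h : RowInv ux w g₀ M ρ g) :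
    ∃ i ≤ ρ, IsLeadIndex ux w (g ρ) i := by
  obtain ⟨i, hi⟩ := exists_isLeadIndex ux w (h.row_ne_zero ρ)
  exact ⟨i, not_lt.mp fun hlt => hi.1 (h.supp ρ le_rfl i hlt), hi⟩

theorem RowInv.reduce (h : RowInv ux w g₀ M ρ g) (hux : 0 < ux)
    (hi : IsLeadIndex ux w (g ρ) i) (hlt : i < ρ) :
    RowInv ux w g₀ M ρ (reduceRows g ρ i) where
  lead t ht := by
    rcases eq_or_ne t i with rfl | hti
    · rcases le_or_gt (g t t).natDegree (g ρ t).natDegree with hd | hd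
      · rw [reduceRows_of_le g hlt.ne hd]; exact h.lead t ht
      · rw [reduceRows_of_lt g hlt.ne hd]; exact hi
    · rw [reduceRows_of_ne g ht.ne hti]; exact h.lead t ht
  supp t ht j hj := by
    rcases eq_or_ne t ρ with rfl | htρ
    · rw [reduceRows_self, cancelLead]
      simp [h.supp t le_rfl j hj, h.supp i hlt.le j hj]
    · rcases eq_or_ne t i with rfl | hti
      · rcases le_or_gt (g t t).natDegree (g ρ t).natDegree with hd | hd
        · rw [reduceRows_of_le g hlt.ne hd]; exact h.supp t ht j hj
        · rw [reduceRows_of_lt g hlt.ne hd]; exact h.supp ρ le_rfl j hj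
      · rw [reduceRows_of_ne g htρ hti]; exact h.supp t ht j hj
  later t ht := by
    rw [reduceRows_of_ne g ht.ne' (hlt.trans ht).ne']; exact h.later t ht
  lower := h.lower
  det_ne := by
    obtain ⟨c, hc, he⟩ := det_reduceRows g hlt.ne (h.lead i hlt).1 hi.1
    rw [he]; exact mul_ne_zero (C_ne_zero.mpr hc) h.det_ne
  det_deg := by
    obtain ⟨c, hc, he⟩ := det_reduceRows g hlt.ne (h.lead i hlt).1 hi.1
    rw [he, natDegree_C_mul hc]; exact h.det_deg
  bound t ht j hj := by
    rcases eq_or_ne t ρ with rfl | htρ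
    · rw [reduceRows_self] at hj ⊢
      have h1 := cancelLead_key_lt hux g hi (h.lead i hlt) hj
      rw [key, Prod.Lex.toLex_lt_toLex] at h1
      have h2 := h.bound i hlt.le i (h.lead i hlt).1
      have h3 := h.bound t le_rfl i hi.1
      have h4 : ((max (g i i).natDegree (g t i).natDegree : ℕ) : ℤ) * ux + w i ≤ M := by
        rcases max_choice (g i i).natDegree (g t i).natDegree with h5 | h5 <;> rw [h5] <;> assumption
      rcases h1 with h1 | h1 <;> simp only at h1
      · exact h1.le.trans h4
      · exact h1.1.le.trans h4
    · rcases eq_or_ne t i with rfl | hti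
      · rcases le_or_gt (g t t).natDegree (g ρ t).natDegree with hd | hd
        · rw [reduceRows_of_le g hlt.ne hd] at hj ⊢; exact h.bound t ht j hj
        · rw [reduceRows_of_lt g hlt.ne hd] at hj ⊢; exact h.bound ρ le_rfl j hj
      · rw [reduceRows_of_ne g htρ hti] at hj ⊢; exact h.bound t ht j hj

/-- The diagonal sum changes by `min - deg g i i`, while the leading weight of row `ρ` falls below
the one with `max` in place of `deg g ρ i`. These two changes of degree cancel because `min + max`
is the sum of the degrees. -/
theorem RowInv.excess_reduce (h : RowInv ux w g₀ M ρ g) (hux : 0 < ux)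
    (hi : IsLeadIndex ux w (g ρ) i) (hlt : i < ρ) {i' : Fin s}
    (hi' : IsLeadIndex ux w (reduceRows g ρ i ρ) i') :
    excess ux w g₀ ρ (reduceRows g ρ i) i' < excess ux w g₀ ρ g i ∨
      (excess ux w g₀ ρ (reduceRows g ρ i) i' = excess ux w g₀ ρ g i ∧ i' < i) := by
  have hsum : ∑ t ∈ Finset.Iio ρ, ((reduceRows g ρ i t t).natDegree : ℤ) + (g i i).natDegree
      = ∑ t ∈ Finset.Iio ρ, ((g t t).natDegree : ℤ)
        + (min (g i i).natDegree (g ρ i).natDegree : ℕ) := by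
    have hmem : i ∈ Finset.Iio ρ := Finset.mem_Iio.mpr hlt
    rw [← Finset.add_sum_erase _ _ hmem, ← Finset.add_sum_erase _ (fun t => ((g t t).natDegree : ℤ))
      hmem, natDegree_reduceRows g hlt.ne]
    rw [Finset.sum_congr rfl fun t ht => by
      rw [reduceRows_of_ne g (Finset.mem_Iio.mp (Finset.mem_of_mem_erase ht)).ne
        (Finset.ne_of_mem_erase ht)]]
    ring
  have hmm : ((min (g i i).natDegree (g ρ i).natDegree : ℕ) : ℤ) +
      (max (g i i).natDegree (g ρ i).natDegree : ℕ) = (g i i).natDegree + (g ρ i).natDegree := by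
    exact_mod_cast min_add_max _ _
  have h1 := hi'.1
  rw [reduceRows_self] at h1
  have h2 := cancelLead_key_lt hux g hi (h.lead i hlt) h1
  rw [key, Prod.Lex.toLex_lt_toLex] at h2
  simp only at h2
  unfold excess
  rw [reduceRows_self]
  have h3 : ux * ∑ t ∈ Finset.Iio ρ, ((reduceRows g ρ i t t).natDegree : ℤ)
      + ((max (g i i).natDegree (g ρ i).natDegree : ℕ) : ℤ) * ux
      = ux * ∑ t ∈ Finset.Iio ρ, ((g t t).natDegree : ℤ) + (g ρ i).natDegree * ux := by
    linear_combination ux * hsum + ux * hmm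
  rcases h2 with h2 | h2
  · left; linarith
  · right; exact ⟨by linarith [h2.1], h2.2⟩

/-- Modulo `ux` the excess depends only on `w` at the leading index. This restricts how the index
can drop while the excess stays constant. -/
theorem dvd_of_excess_eq {g' : Fin s → Fin s → K[X]} {i' : Fin s}
    (h : excess ux w g₀ ρ g' i' = excess ux w g₀ ρ g i) : ux ∣ w i - w i' := by
  unfold excess at h
  refine ⟨(g' ρ i').natDegree + ∑ t ∈ Finset.Iio ρ, ((g' t t).natDegree : ℤ)
    - (g ρ i).natDegree - ∑ t ∈ Finset.Iio ρ, ((g t t).natDegree : ℤ), ?_⟩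
  linear_combination -h

/-- Rows up to `ρ` have no entry beyond column `ρ` and later rows are lower triangular, so a
nonvanishing Leibniz term is diagonal after `ρ`. -/
theorem RowInv.perm_apply (h : RowInv ux w g₀ M ρ g) {σ : Equiv.Perm (Fin s)}
    (hσ : ∀ r, g r (σ r) ≠ 0) {r : Fin s} (hr : ρ < r) : σ r = r := by
  have hle : ∀ r, ρ < r → σ r ≤ r := fun r hr => not_lt.mp fun hlt => by
    apply hσ r; rw [h.later r hr]; exact h.lower _ _ hlt
  refine le_antisymm (hle r hr) (Perm.le_apply_of_forall_lt σ fun t ht => ?_)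
  rcases le_or_gt t ρ with h1 | h1
  · exact (not_lt.mp fun hlt => hσ t (h.supp t h1 _ hlt) : σ t ≤ ρ).trans_lt hr
  · exact (hle t h1).trans_lt ht

/-- Up to row `ρ`, `if r = ρ then i else r` is the leading index. Later rows may lead elsewhere, but
there the Leibniz term uses only the diagonal entry. -/
theorem RowInv.perm_weight_le (h : RowInv ux w g₀ M ρ g) (hi : IsLeadIndex ux w (g ρ) i)
    {σ : Equiv.Perm (Fin s)} (hσ : ∀ r, g r (σ r) ≠ 0) (r : Fin s) :
    ((g r (σ r)).natDegree : ℤ) * ux + w (σ r) <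
        (g r (if r = ρ then i else r)).natDegree * ux + w (if r = ρ then i else r) ∨
      (((g r (σ r)).natDegree : ℤ) * ux + w (σ r) =
        (g r (if r = ρ then i else r)).natDegree * ux + w (if r = ρ then i else r) ∧
        σ r ≤ if r = ρ then i else r) := by
  rcases lt_trichotomy r ρ with hr | rfl | hr
  · rw [if_neg hr.ne]
    exact key_le_key_iff.mp ((h.lead r hr).2 _ (hσ r))
  · rw [if_pos rfl]
    exact key_le_key_iff.mp (hi.2 _ (hσ r))
  · rw [if_neg hr.ne', h.perm_apply hσ hr]
    exact Or.inr ⟨rfl, le_rfl⟩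

theorem RowInv.perm_sum_le (h : RowInv ux w g₀ M ρ g) (hi : IsLeadIndex ux w (g ρ) i)
    {σ : Equiv.Perm (Fin s)} (hσ : ∀ r, g r (σ r) ≠ 0) :
    (∑ r, ((g r (σ r)).natDegree : ℤ)) * ux + ∑ r, w r <
        ∑ r, (((g r (if r = ρ then i else r)).natDegree : ℤ) * ux + w (if r = ρ then i else r)) ∨
      ((∑ r, ((g r (σ r)).natDegree : ℤ)) * ux + ∑ r, w r =
        ∑ r, (((g r (if r = ρ then i else r)).natDegree : ℤ) * ux + w (if r = ρ then i else r)) ∧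
        ∀ r, σ r ≤ if r = ρ then i else r) := by
  rw [← Equiv.sum_comp σ w, Finset.sum_mul, ← Finset.sum_add_distrib]
  have hle := fun r => h.perm_weight_le hi hσ r
  by_cases hall : ∀ r, σ r ≤ if r = ρ then i else r
  · rcases lt_or_eq_of_le (Finset.sum_le_sum fun r (_ : r ∈ Finset.univ) =>
      (hle r).elim le_of_lt fun e => e.1.le) with h1 | h1
    exacts [Or.inl h1, Or.inr ⟨h1, hall⟩]
  · left
    push Not at hall
    obtain ⟨r, hr⟩ := hall
    refine Finset.sum_lt_sum (fun r _ => (hle r).elim le_of_lt fun e => e.1.le)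
      ⟨r, Finset.mem_univ r, (hle r).resolve_right fun e => hr.not_ge e.2⟩

theorem RowInv.sum_lead_eq (h : RowInv ux w g₀ M ρ g) :
    ∑ r, (((g r (if r = ρ then i else r)).natDegree : ℤ) * ux + w (if r = ρ then i else r))
      = excess ux w g₀ ρ g i + (∑ t, ((g₀ t t).natDegree : ℤ)) * ux + ∑ t, w t := by
  rw [sum_univ_eq _ ρ, sum_Iic_eq, sum_univ_eq (fun t => ((g₀ t t).natDegree : ℤ)) ρ,
    sum_univ_eq w ρ, sum_Iic_eq w, excess, if_pos rfl,
    Finset.sum_congr (s₁ := Finset.Iio ρ) rfl fun t ht => by rw [if_neg (Finset.mem_Iio.mp ht).ne],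
    Finset.sum_congr (s₁ := Finset.Ioi ρ) rfl fun t ht => by
      rw [if_neg (Finset.mem_Ioi.mp ht).ne', h.later t (Finset.mem_Ioi.mp ht)],
    Finset.sum_add_distrib, Finset.sum_add_distrib, ← Finset.sum_mul, ← Finset.sum_mul]
  ring

/-- A Leibniz term that reaches the degree of the determinant makes the excess nonnegative. Equality
would force `σ r ≤ r` everywhere, hence `σ = 1`, and then `ρ ≤ i`. -/
theorem RowInv.excess_pos (h : RowInv ux w g₀ M ρ g) (hux : 0 < ux)
    (hi : IsLeadIndex ux w (g ρ) i) (hlt : i < ρ) : 0 < excess ux w g₀ ρ g i := by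
  obtain ⟨σ, hσ, hdeg⟩ := exists_perm_natDegree_det_le g h.det_ne
  rw [h.det_deg] at hdeg
  have hdeg' : (∑ t, ((g₀ t t).natDegree : ℤ)) * ux ≤ (∑ r, ((g r (σ r)).natDegree : ℤ)) * ux := by
    refine mul_le_mul_of_nonneg_right ?_ hux.le
    exact_mod_cast hdeg
  have h1 := h.perm_sum_le hi hσ
  rw [h.sum_lead_eq] at h1
  rcases h1 with h1 | ⟨-, h1⟩
  · linarith
  · exfalso
    have h2 : σ = 1 := Perm.eq_one_of_forall_le σ fun r => (h1 r).trans (by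
      split_ifs with hr
      exacts [hr ▸ hlt.le, le_rfl])
    have h3 := h1 ρ
    rw [if_pos rfl, h2] at h3
    exact hlt.not_ge h3

/-- Once row `ρ` leads on the diagonal, the identity strictly beats every other nonvanishing
permutation, so the determinant bounds the diagonal degrees. This renews the bound on the excess for
the next row. -/
theorem RowInv.sum_diag_le (h : RowInv ux w g₀ M ρ g) (hux : 0 < ux)
    (hi : IsLeadIndex ux w (g ρ) ρ) (hg₀ : ∀ t, g₀ t t ≠ 0) :
    ∑ t ∈ Finset.Iic ρ, (g t t).natDegree ≤ ∑ t ∈ Finset.Iic ρ, (g₀ t t).natDegree := by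
  have hif : ∀ r, (if r = ρ then ρ else r) = r := fun r => by split_ifs with h <;> simp [h]
  have hN : ∑ t, (g t t).natDegree ≤ ∑ t, (g₀ t t).natDegree := by
    rw [← h.det_deg]
    refine sum_natDegree_le_natDegree_det g (fun r => ?_) fun σ hσ1 hσ => ?_
    · rcases lt_trichotomy r ρ with hr | rfl | hr
      exacts [(h.lead r hr).1, hi.1, h.later r hr ▸ hg₀ r]
    · have h1 := h.perm_sum_le hi hσ
      simp only [hif] at h1
      rcases h1 with h1 | ⟨-, h1⟩
      · rw [Finset.sum_add_distrib, ← Finset.sum_mul] at h1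
        have h2 := lt_of_mul_lt_mul_right (lt_of_add_lt_add_right h1) hux.le
        exact_mod_cast h2
      · exact absurd (Perm.eq_one_of_forall_le σ h1) hσ1
  rw [sum_univ_eq _ ρ, sum_univ_eq (fun t => (g₀ t t).natDegree) ρ,
    Finset.sum_congr (s₁ := Finset.Ioi ρ) rfl fun t ht => by rw [h.later t (Finset.mem_Ioi.mp ht)]]
    at hN
  exact Nat.le_of_add_le_add_right hN

end RowInvariant

/-! ### From the cost of each row to the whole run. -/

section Run

variable {ux : ℤ} {w : Fin s → ℤ}

/-- `n` is the remaining budget: `mults` grows and `mults + n` does not, so `n` falls. One potential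
thus yields both termination and the cost. -/
theorem exists_iterate_step {R : State K s → ℕ → Prop} {T : State K s → Prop}
    (hR : ∀ σ n, R σ n → T σ ∨ ∃ n', R (step ux w σ) n' ∧ σ.mults < (step ux w σ).mults ∧
      (step ux w σ).mults + n' ≤ σ.mults + n) (σ : State K s) (n : ℕ) (h : R σ n) :
    ∃ k n', R ((step ux w)^[k] σ) n' ∧ T ((step ux w)^[k] σ) ∧
      ((step ux w)^[k] σ).mults ≤ σ.mults + n := by
  induction n using Nat.strong_induction_on generalizing σ with
  | _ n ih =>
    rcases hR σ n h with hT | ⟨n', h1, h2, h3⟩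
    · exact ⟨0, n, h, hT, Nat.le_add_right _ _⟩
    · obtain ⟨k, n'', h4, h5, h6⟩ := ih n' (by omega) _ h1
      exact ⟨k + 1, n'', by simpa using h4, by simpa using h5, by simpa using h6.trans h3⟩

/-- The state at the moment when the algorithm turns to row `ρ`. -/
structure RowStart (ux : ℤ) (w : Fin s → ℤ) (g₀ : Fin s → Fin s → K[X]) (M : ℤ) (ρ : Fin s)
    (σ : State K s) : Prop where
  row : σ.row = ρ
  inv : RowInv ux w g₀ M ρ σ.g
  untouched : σ.g ρ = g₀ ρ
  sum_diag : ∑ t ∈ Finset.Iio ρ, (σ.g t t).natDegree ≤ ∑ t ∈ Finset.Iio ρ, (g₀ t t).natDegree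

variable {g₀ : Fin s → Fin s → K[X]} {M : ℤ} {ρ : Fin s}

/-- If every row can be finished within `R ρ` multiplications, the algorithm terminates within
the sum of the `R ρ`. -/
theorem halts_of_row_cost (hux : 0 < ux) (hlow : ∀ t j, t < j → g₀ t j = 0)
    (hdiag : ∀ t, g₀ t t ≠ 0)
    (hM : ∀ t j, g₀ t j ≠ 0 → ((g₀ t j).natDegree : ℤ) * ux + w j ≤ M) (R : Fin s → ℕ)
    (hrow : ∀ (ρ : Fin s) (σ : State K s), RowStart ux w g₀ M ρ σ → (∀ t < ρ, σ.g t ρ = 0) →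
      ∃ k, ((step ux w)^[k] σ).row = ρ ∧ RowInv ux w g₀ M ρ ((step ux w)^[k] σ).g ∧
        IsLeadIndex ux w (((step ux w)^[k] σ).g ρ) ρ ∧
        ((step ux w)^[k] σ).mults ≤ σ.mults + R ρ) :
    ∃ N ≤ ∑ ρ, R ρ, HaltsWithMultiplications ux w g₀ N := by
  have hdet : Matrix.det (Matrix.of g₀) = ∏ t, g₀ t t := by
    rw [Matrix.det_of_isLowerTriangular]
    · rfl
    · intro a b hab; exact hlow _ _ hab
  have main : ∀ n, n ≤ s → ∃ k, (run ux w g₀ k).row = n ∧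
      (∀ ρ : Fin s, (ρ : ℕ) = n → RowStart ux w g₀ M ρ (run ux w g₀ k) ∧
        ∀ t < ρ, (run ux w g₀ k).g t ρ = 0) ∧
      (run ux w g₀ k).mults ≤ ∑ ρ ∈ Finset.univ.filter (fun ρ : Fin s => (ρ : ℕ) < n), R ρ := by
    intro n
    induction n with
    | zero =>
      intro _
      refine ⟨0, rfl, fun ρ hρ => ⟨⟨hρ.symm, ⟨?_, ?_, fun _ _ => rfl, hlow, ?_, ?_, ?_⟩, rfl, ?_⟩, ?_⟩,
        Nat.zero_le _⟩
      · intro t ht; have := Fin.lt_def.mp ht; omega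
      · intro t ht j hj; exact hlow t j (ht.trans_lt hj)
      · change Matrix.det (Matrix.of g₀) ≠ 0
        rw [hdet]; exact Finset.prod_ne_zero_iff.mpr fun t _ => hdiag t
      · change (Matrix.det (Matrix.of g₀)).natDegree = _
        rw [hdet, natDegree_prod _ _ fun t _ => hdiag t]
      · exact fun t _ j => hM t j
      · exact le_rfl
      · intro t ht; have := Fin.lt_def.mp ht; omega
    | succ n ih =>
      intro hn
      obtain ⟨k, hk, hstart, hmult⟩ := ih (by omega)
      obtain ⟨hst, hcol⟩ := hstart ⟨n, hn⟩ rfl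
      obtain ⟨k', h1, h2, h3, h4⟩ := hrow ⟨n, hn⟩ _ hst hcol
      set τ := (step ux w)^[k'] (run ux w g₀ k) with hτ
      -- One more pass finds the leading index on the diagonal and moves on, free of charge.
      have hrun : run ux w g₀ (k' + k + 1) = { τ with row := τ.row + 1 } := by
        rw [run, Function.iterate_succ_apply', Function.iterate_add_apply]
        change step ux w τ = _
        obtain ⟨row, g, mu⟩ := τ
        simp only at h1
        subst h1
        exact step_of_lead_self (σ := ⟨_, g, mu⟩) hn h3
      refine ⟨k' + k + 1, ?_, ?_, ?_⟩
      · rw [hrun]; simp [h1]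
      · intro ρ hρ
        have hlt : (⟨n, hn⟩ : Fin s) < ρ := Fin.lt_def.mpr (by simp [hρ])
        have hle : ∀ t < ρ, t ≤ ⟨n, hn⟩ := fun t ht => Fin.le_def.mpr (by
          have := Fin.lt_def.mp ht; simp; omega)
        have hIio : Finset.Iio ρ = Finset.Iic ⟨n, hn⟩ := by
          ext t
          simp only [Finset.mem_Iio, Finset.mem_Iic]
          exact ⟨hle t, fun h => h.trans_lt hlt⟩
        rw [hrun]
        refine ⟨⟨by simp [h1, hρ], ⟨?_, ?_, ?_, hlow, h2.det_ne, h2.det_deg, ?_⟩, ?_, ?_⟩, ?_⟩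
        · intro t ht
          rcases (hle t ht).lt_or_eq with h5 | rfl
          exacts [h2.lead t h5, h3]
        · intro t ht j hj
          rcases ht.lt_or_eq with h5 | rfl
          · exact h2.supp t (hle t h5) j (hlt.trans hj)
          · change τ.g t j = 0
            rw [h2.later t hlt]; exact hlow t j hj
        · exact fun t ht => h2.later t (hlt.trans ht)
        · intro t ht j
          rcases ht.lt_or_eq with h5 | rfl
          · exact h2.bound t (hle t h5) j
          · change τ.g t j ≠ 0 → ((τ.g t j).natDegree : ℤ) * ux + w j ≤ M
            rw [h2.later t hlt]; exact hM t j
        · exact h2.later ρ hlt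
        · rw [hIio]; exact h2.sum_diag_le hux h3 hdiag
        · exact fun t ht => h2.supp t (hle t ht) ρ hlt
      · rw [hrun]
        have hset : (Finset.univ.filter fun ρ : Fin s => (ρ : ℕ) < n + 1)
            = insert ⟨n, hn⟩ (Finset.univ.filter fun ρ : Fin s => (ρ : ℕ) < n) := by
          ext t
          simp [Fin.ext_iff]; omega
        rw [hset, Finset.sum_insert (by simp)]
        change τ.mults ≤ _
        omega
  obtain ⟨k, hk, -, hm⟩ := main s le_rfl
  refine ⟨_, hm.trans (Finset.sum_le_sum_of_subset (Finset.filter_subset _ _)), k, hk.ge, rfl⟩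

end Run

/-! ### The cost of one row. -/

section RowCost

variable {ux : ℤ} {w : Fin s → ℤ} {g₀ : Fin s → Fin s → K[X]} {M : ℤ} {ρ : Fin s}

theorem denseSize_le_of_weight_le {a M : ℕ} (ha : 0 < a) {v : Fin s → K[X]}
    (hw : ∀ j, 0 ≤ w j) (hsupp : ∀ j, ρ < j → v j = 0)
    (hM : ∀ j, v j ≠ 0 → ((v j).natDegree : ℤ) * a + w j ≤ M) :
    denseSize v ≤ (ρ + 1) * (M / a + 1) := by
  classical
  have hcard : (Finset.Iic ρ).card = (ρ : ℕ) + 1 := Fin.card_Iic ρ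
  rw [← hcard, ← smul_eq_mul, ← Finset.sum_const, denseSize, sum_univ_eq _ ρ,
    Finset.sum_eq_zero (s := Finset.Ioi ρ) fun j hj => if_pos (hsupp j (Finset.mem_Ioi.mp hj)),
    add_zero]
  refine Finset.sum_le_sum fun j _ => ?_
  split_ifs with h0
  · exact Nat.zero_le _
  · have h1 : (v j).natDegree * a ≤ M := by
      have := hM j h0
      have := hw j
      zify; linarith
    exact Nat.succ_le_succ ((Nat.le_div_iff_mul_le ha).mpr h1)

/-- Ties favour the larger index, so an entry after `i` weighs strictly less than the leading term.
Only the `i + 1` entries up to `i` can have one coefficient more than the leading weight. -/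
theorem denseSize_le_of_lead {wt : Fin s → ℕ} {v : Fin s → K[X]} {i : Fin s}
    (hi : IsLeadIndex 1 (fun j => (wt j : ℤ)) v i) (S : Finset (Fin s))
    (hS : ∀ j, v j ≠ 0 → j ∈ S) :
    denseSize v ≤ (i + 1) + S.card * ((v i).natDegree + wt i) := by
  classical
  have hcard : (Finset.Iic i).card = (i : ℕ) + 1 := Fin.card_Iic i
  have h1 : ∑ j, (if j ∈ Finset.Iic i then 1 else 0) = (i : ℕ) + 1 := by
    rw [← Finset.sum_filter, Finset.filter_mem_eq_inter, Finset.univ_inter,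
      ← Finset.card_eq_sum_ones, hcard]
  have h2 : ∑ j, (if j ∈ S then (v i).natDegree + wt i else 0)
      = S.card * ((v i).natDegree + wt i) := by
    rw [← Finset.sum_filter, Finset.filter_mem_eq_inter, Finset.univ_inter, Finset.sum_const,
      smul_eq_mul]
  rw [← h1, ← h2, ← Finset.sum_add_distrib, denseSize]
  refine Finset.sum_le_sum fun j _ => ?_
  by_cases h0 : v j = 0
  · rw [if_pos h0]; exact Nat.zero_le _
  · rw [if_neg h0, if_pos (hS j h0)]
    rcases le_or_gt j i with hj | hj
    · have := hi.weight_le h0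
      rw [if_pos (Finset.mem_Iic.mpr hj)]
      omega
    · have := hi.weight_lt h0 hj
      omega

theorem RowStart.excess_le {σ : State K s} (h : RowStart ux w g₀ M ρ σ) (hux : 0 < ux) {Δ : ℕ}
    (hΔ : ∀ j, g₀ ρ j ≠ 0 → ((g₀ ρ j).natDegree : ℤ) * ux + w j
      ≤ w ρ + ux * (g₀ ρ ρ).natDegree + Δ) {i : Fin s} (hi : σ.g ρ i ≠ 0) :
    excess ux w g₀ ρ σ.g i ≤ Δ := by
  have h1 : ux * ∑ t ∈ Finset.Iio ρ, ((σ.g t t).natDegree : ℤ)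
      ≤ ux * ∑ t ∈ Finset.Iio ρ, ((g₀ t t).natDegree : ℤ) := by
    refine mul_le_mul_of_nonneg_left ?_ hux.le
    exact_mod_cast h.sum_diag
  rw [h.untouched] at hi
  have h2 := hΔ i hi
  rw [excess, h.untouched, sum_Iic_eq]
  linarith

/-- With excess `E + 1` at least `E * c + blk i + 1` replacements are budgeted. A drop of the excess
frees `c`, more than any block number; at constant excess the block number itself drops. -/
theorem row_cost_le_of_residues (hux : 0 < ux) {Δ c cost : ℕ} (blk : Fin s → ℕ)
    (hblk : ∀ i j, i < j → ux ∣ w j - w i → blk i < blk j) (hc : ∀ i < ρ, blk i < c)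
    (hcost : ∀ g, RowInv ux w g₀ M ρ g → ∀ i < ρ, 1 + denseSize (g i) ≤ cost)
    (hΔ : ∀ j, g₀ ρ j ≠ 0 → ((g₀ ρ j).natDegree : ℤ) * ux + w j
      ≤ w ρ + ux * (g₀ ρ ρ).natDegree + Δ)
    (σ : State K s) (hσ : RowStart ux w g₀ M ρ σ) :
    ∃ k, ((step ux w)^[k] σ).row = ρ ∧ RowInv ux w g₀ M ρ ((step ux w)^[k] σ).g ∧
      IsLeadIndex ux w (((step ux w)^[k] σ).g ρ) ρ ∧
      ((step ux w)^[k] σ).mults ≤ σ.mults + cost * (Δ * c) := by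
  set R : State K s → ℕ → Prop := fun τ n => τ.row = ρ ∧ RowInv ux w g₀ M ρ τ.g ∧
    ∃ i ≤ ρ, IsLeadIndex ux w (τ.g ρ) i ∧
      (i < ρ → ∃ E : ℕ, excess ux w g₀ ρ τ.g i = E + 1 ∧ n = cost * (E * c + blk i + 1)) with hR
  have hfresh : ∀ g, RowInv ux w g₀ M ρ g → ∀ i, IsLeadIndex ux w (g ρ) i → i < ρ →
      ∃ E : ℕ, excess ux w g₀ ρ g i = E + 1 := fun g hg i hi hlt => by
    have := hg.excess_pos hux hi hlt
    exact ⟨(excess ux w g₀ ρ g i - 1).toNat, by omega⟩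
  have hstep : ∀ τ n, R τ n → IsLeadIndex ux w (τ.g ρ) ρ ∨ ∃ n', R (step ux w τ) n' ∧
      τ.mults < (step ux w τ).mults ∧ (step ux w τ).mults + n' ≤ τ.mults + n := by
    rintro τ n ⟨hrow, hinv, i, hile, hi, hn⟩
    rcases hile.lt_or_eq with hlt | rfl
    swap
    · exact Or.inl hi
    right
    obtain ⟨E, hE, rfl⟩ := hn hlt
    rw [step_of_lead_ne hrow hi hlt.ne]
    have hinv' := hinv.reduce hux hi hlt
    have hcost' := hcost _ hinv i hlt
    obtain ⟨i', hile', hi'⟩ := hinv'.exists_lead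
    rcases hile'.lt_or_eq with hlt' | rfl
    · obtain ⟨E', hE'⟩ := hfresh _ hinv' i' hi' hlt'
      refine ⟨cost * (E' * c + blk i' + 1), ⟨hrow, hinv', i', hile', hi', fun _ => ⟨E', hE', rfl⟩⟩,
        by simp only; omega, ?_⟩
      have hlt2 : E' * c + blk i' + 1 + 1 ≤ E * c + blk i + 1 := by
        rcases hinv.excess_reduce hux hi hlt hi' with h1 | ⟨h1, h2⟩
        · have h3 : E' + 1 ≤ E := by omega
          have h4 := hc i' hlt'
          nlinarith
        · have h3 : E' = E := by omega
          have h4 := hblk i' i h2 (dvd_of_excess_eq h1)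
          rw [h3]; omega
      have := Nat.mul_le_mul_left cost hlt2
      simp only
      nlinarith
    · refine ⟨0, ⟨hrow, hinv', i', le_rfl, hi', fun h => absurd h (lt_irrefl _)⟩,
        by simp only; omega, ?_⟩
      have : cost * 1 ≤ cost * (E * c + blk i + 1) := Nat.mul_le_mul_left _ (by omega)
      simp only
      omega
  obtain ⟨i, hile, hi⟩ := hσ.inv.exists_lead
  have hinit : ∃ n ≤ cost * (Δ * c), R σ n := by
    rcases hile.lt_or_eq with hlt | rfl
    · obtain ⟨E, hE⟩ := hfresh _ hσ.inv i hi hlt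
      refine ⟨_, ?_, hσ.row, hσ.inv, i, hile, hi, fun _ => ⟨E, hE, rfl⟩⟩
      have h1 := hσ.excess_le hux hΔ hi.1
      have h2 : E + 1 ≤ Δ := by omega
      have h3 := hc i hlt
      refine Nat.mul_le_mul_left _ ?_
      nlinarith
    · exact ⟨0, Nat.zero_le _, hσ.row, hσ.inv, i, le_rfl, hi, fun h => absurd h (lt_irrefl _)⟩
  obtain ⟨n, hn, hRn⟩ := hinit
  obtain ⟨k, n', h1, h2, h3⟩ := exists_iterate_step hstep σ n hRn
  exact ⟨k, h1.1, h1.2.1, h2, by omega⟩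

/-- For each value of the excess a pivot `t` serves at most once, hence at most `Δ` times in all.
Column `ρ` of the earlier rows starts empty and is filled in row `t` only by a swap, so the first
use of `t` never pays for that column: this is the `Δ - 1`. -/
theorem row_cost_le_of_weights {wt : Fin s → ℕ} {Δ : ℕ}
    (hΔ : ∀ j, g₀ ρ j ≠ 0 → ((g₀ ρ j).natDegree : ℤ) * 1 + (wt j : ℤ)
      ≤ wt ρ + 1 * (g₀ ρ ρ).natDegree + Δ)
    (σ : State K s) (hσ : RowStart 1 (fun j => (wt j : ℤ)) g₀ M ρ σ)
    (hcol : ∀ t < ρ, σ.g t ρ = 0) :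
    ∃ k, ((step 1 (fun j => (wt j : ℤ)))^[k] σ).row = ρ ∧
      RowInv 1 (fun j => (wt j : ℤ)) g₀ M ρ ((step 1 (fun j => (wt j : ℤ)))^[k] σ).g ∧
      IsLeadIndex 1 (fun j => (wt j : ℤ)) (((step 1 (fun j => (wt j : ℤ)))^[k] σ).g ρ) ρ ∧
      ((step 1 (fun j => (wt j : ℤ)))^[k] σ).mults ≤ σ.mults + ∑ t ∈ Finset.Iio ρ,
        ((t + 2 + ρ * ((σ.g t t).natDegree + wt t)) * Δ +
          ((σ.g t t).natDegree + wt t - (ρ + 1)) * (Δ - 1)) := by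
  classical
  set w : Fin s → ℤ := fun j => (wt j : ℤ) with hw
  set A : Fin s → ℕ := fun t => (σ.g t t).natDegree + wt t with hA
  -- The remaining budget at excess `E + 1` and leading index `i`: a pivot `t ≤ i` may still serve
  -- at `E + 1` values of the excess, a pivot `t > i` only at `E`. One use fewer is charged for
  -- column `ρ` while that entry of row `t` is zero.
  set B : ℕ → Fin s → (Fin s → Fin s → K[X]) → ℕ := fun E i g => ∑ t ∈ Finset.Iio ρ,
    ((t + 2 + ρ * A t) * (if t ≤ i then E + 1 else E) +
      (A t - (ρ + 1)) * (if g t ρ = 0 then (if t ≤ i then E + 1 else E) - 1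
        else if t ≤ i then E + 1 else E)) with hB
  set R : State K s → ℕ → Prop := fun τ n => τ.row = ρ ∧ RowInv 1 w g₀ M ρ τ.g ∧
    (∀ t < ρ, (τ.g t t).natDegree ≤ (σ.g t t).natDegree ∧
      (τ.g t ρ ≠ 0 → (τ.g t t).natDegree + 1 ≤ (σ.g t t).natDegree)) ∧
    ∃ i ≤ ρ, IsLeadIndex 1 w (τ.g ρ) i ∧
      (i < ρ → ∃ E : ℕ, excess 1 w g₀ ρ τ.g i = E + 1 ∧ n = B E i τ.g) with hR
  have hfresh : ∀ g, RowInv 1 w g₀ M ρ g → ∀ i, IsLeadIndex 1 w (g ρ) i → i < ρ →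
      ∃ E : ℕ, excess 1 w g₀ ρ g i = E + 1 := fun g hg i hi hlt => by
    have := hg.excess_pos one_pos hi hlt
    exact ⟨(excess 1 w g₀ ρ g i - 1).toNat, by omega⟩
  have hcost : ∀ g, RowInv 1 w g₀ M ρ g → ∀ i < ρ, (g i i).natDegree ≤ (σ.g i i).natDegree →
      (g i ρ ≠ 0 → (g i i).natDegree + 1 ≤ (σ.g i i).natDegree) →
      1 + denseSize (g i) ≤ i + 2 + ρ * A i + if g i ρ = 0 then 0 else A i - (ρ + 1) := by
    intro g hg i hlt h1 h2
    split_ifs with h0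
    · have := denseSize_le_of_lead (hg.lead i hlt) (Finset.Iio ρ) fun j hj => by
        rw [Finset.mem_Iio]
        refine lt_of_le_of_ne (not_lt.mp fun h => hj (hg.supp i hlt.le j h)) ?_
        rintro rfl; exact hj h0
      rw [Fin.card_Iio] at this
      have h3 : (ρ : ℕ) * ((g i i).natDegree + wt i) ≤ ρ * A i :=
        Nat.mul_le_mul_left _ (by simp only [hA]; omega)
      omega
    · have := denseSize_le_of_lead (hg.lead i hlt) (Finset.Iic ρ) fun j hj => by
        rw [Finset.mem_Iic]
        exact not_lt.mp fun h => hj (hg.supp i hlt.le j h)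
      rw [Fin.card_Iic] at this
      -- A filled column `ρ` means that the leading weight is at most `A i - 1`; over `ρ + 1`
      -- columns this saves `ρ + 1`.
      have h3 : ((ρ : ℕ) + 1) * ((g i i).natDegree + wt i + 1) ≤ (ρ + 1) * A i :=
        Nat.mul_le_mul_left _ (by have := h2 h0; simp only [hA]; omega)
      have h4 : ((ρ : ℕ) + 1) * ((g i i).natDegree + wt i + 1)
        = (ρ + 1) * ((g i i).natDegree + wt i) + (ρ + 1) := by ring
      have h5 : ((ρ : ℕ) + 1) * A i = ρ * A i + A i := by ring
      omega
  have hpos : ∀ E i (g : Fin s → Fin s → K[X]), i < ρ → (i + 2 + ρ * A i) * (E + 1) +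
      (A i - (ρ + 1)) * (if g i ρ = 0 then E else E + 1) ≤ B E i g := by
    intro E i g hlt
    refine le_trans (le_of_eq ?_) (Finset.single_le_sum (fun t _ => Nat.zero_le _)
      (Finset.mem_Iio.mpr hlt))
    simp
  have hstep : ∀ τ n, R τ n → IsLeadIndex 1 w (τ.g ρ) ρ ∨ ∃ n', R (step 1 w τ) n' ∧
      τ.mults < (step 1 w τ).mults ∧ (step 1 w τ).mults + n' ≤ τ.mults + n := by
    rintro τ n ⟨hrow, hinv, hdeg, i, hile, hi, hn⟩
    rcases hile.lt_or_eq with hlt | rfl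
    swap
    · exact Or.inl hi
    right
    obtain ⟨E, hE, rfl⟩ := hn hlt
    rw [step_of_lead_ne hrow hi hlt.ne]
    have hinv' := hinv.reduce one_pos hi hlt
    have hcost' := hcost _ hinv i hlt (hdeg i hlt).1 (hdeg i hlt).2
    have hdeg' : ∀ t < ρ, (reduceRows τ.g ρ i t t).natDegree ≤ (σ.g t t).natDegree ∧
        (reduceRows τ.g ρ i t ρ ≠ 0 →
          (reduceRows τ.g ρ i t t).natDegree + 1 ≤ (σ.g t t).natDegree) := by
      intro t ht
      rcases eq_or_ne t i with rfl | hti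
      · rcases le_or_gt (τ.g t t).natDegree (τ.g ρ t).natDegree with hd | hd
        · rw [reduceRows_of_le _ hlt.ne hd]; exact hdeg t ht
        · rw [reduceRows_of_lt _ hlt.ne hd]
          have := (hdeg t ht).1
          exact ⟨by omega, fun _ => by omega⟩
      · rw [reduceRows_of_ne _ ht.ne hti]; exact hdeg t ht
    obtain ⟨i', hile', hi'⟩ := hinv'.exists_lead
    rcases hile'.lt_or_eq with hlt' | rfl
    · obtain ⟨E', hE'⟩ := hfresh _ hinv' i' hi' hlt'
      refine ⟨B E' i' (reduceRows τ.g ρ i), ⟨hrow, hinv', hdeg', i', hile', hi',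
        fun _ => ⟨E', hE', rfl⟩⟩, by simp only; omega, ?_⟩
      have hlex : E' + 1 ≤ E ∨ (E' = E ∧ i' < i) := by
        rcases hinv.excess_reduce one_pos hi hlt hi' with h1 | ⟨h1, h2⟩
        · left; omega
        · right; exact ⟨by omega, h2⟩
      have hrem : ∀ t, (if t ≤ i' then E' + 1 else E') ≤ if t ≤ i then E + 1 else E := by
        intro t
        rcases hlex with h1 | ⟨rfl, h1⟩
        · split_ifs <;> omega
        · split_ifs with h2 h3
          · exact le_rfl
          · exact absurd (h2.trans h1.le) h3
          · omega
          · exact le_rfl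
      -- The pivot just used cannot recur at the same excess.
      have hremi : (if i ≤ i' then E' + 1 else E') ≤ E := by
        rcases hlex with h1 | ⟨rfl, h1⟩
        · split_ifs <;> omega
        · rw [if_neg h1.not_ge]
      have hBB : B E' i' (reduceRows τ.g ρ i) + (1 + denseSize (τ.g i)) ≤ B E i τ.g := by
        have hmem : i ∈ Finset.Iio ρ := Finset.mem_Iio.mpr hlt
        simp only [hB]
        rw [← Finset.add_sum_erase _ _ hmem,
          ← Finset.add_sum_erase _ (fun t : Fin s => ((t : ℕ) + 2 + ρ * A t) * (if t ≤ i then E + 1 else E) +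
      (A t - (ρ + 1)) * (if τ.g t ρ = 0 then (if t ≤ i then E + 1 else E) - 1
        else if t ≤ i then E + 1 else E)) hmem]
        have hrest := Finset.sum_le_sum (s := (Finset.Iio ρ).erase i)
          (f := fun t : Fin s => ((t : ℕ) + 2 + ρ * A t) * (if t ≤ i' then E' + 1 else E') +
      (A t - (ρ + 1)) * (if reduceRows τ.g ρ i t ρ = 0 then (if t ≤ i' then E' + 1 else E') - 1
        else if t ≤ i' then E' + 1 else E'))
          (g := fun t : Fin s => ((t : ℕ) + 2 + ρ * A t) * (if t ≤ i then E + 1 else E) +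
      (A t - (ρ + 1)) * (if τ.g t ρ = 0 then (if t ≤ i then E + 1 else E) - 1
        else if t ≤ i then E + 1 else E)) (fun t ht => by
            have h1 := Finset.mem_erase.mp ht
            have h2 := hrem t
            rw [reduceRows_of_ne _ (Finset.mem_Iio.mp h1.2).ne h1.1]
            refine Nat.add_le_add (Nat.mul_le_mul_left _ h2) (Nat.mul_le_mul_left _ ?_)
            by_cases h0 : τ.g t ρ = 0
            · rw [if_pos h0, if_pos h0]; exact Nat.sub_le_sub_right h2 1
            · rw [if_neg h0, if_neg h0]; exact h2)
        set r' := (if i ≤ i' then E' + 1 else E')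
        have hi1 : ((i : ℕ) + 2 + ρ * A i) * r' + (i + 2 + ρ * A i)
            ≤ (i + 2 + ρ * A i) * (if i ≤ i then E + 1 else E) := by
          rw [if_pos le_rfl, Nat.mul_succ]
          exact Nat.add_le_add_right (Nat.mul_le_mul_left _ hremi) _
        have hi2 : (A i - (ρ + 1)) * (if reduceRows τ.g ρ i i ρ = 0 then r' - 1 else r')
            + (if τ.g i ρ = 0 then 0 else A i - (ρ + 1)) ≤
            (A i - (ρ + 1)) * (if τ.g i ρ = 0 then (if i ≤ i then E + 1 else E) - 1
              else if i ≤ i then E + 1 else E) := by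
          rw [if_pos (le_refl i)]
          have h1 : (if reduceRows τ.g ρ i i ρ = 0 then r' - 1 else r') ≤ E := by
            split_ifs <;> omega
          have h2 := Nat.mul_le_mul_left (A i - ((ρ : ℕ) + 1)) h1
          by_cases h0 : τ.g i ρ = 0
          · simpa [h0] using h2
          · simp only [h0, if_false, Nat.mul_succ]
            exact Nat.add_le_add_right h2 _
        omega
      simp only
      omega
    · refine ⟨0, ⟨hrow, hinv', hdeg', i', le_rfl, hi', fun h => absurd h (lt_irrefl _)⟩,
        by simp only; omega, ?_⟩
      have h1 := hpos E i τ.g hlt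
      have h2 : ((i : ℕ) + 2 + i' * A i) * 1 ≤ (i + 2 + i' * A i) * (E + 1) :=
        Nat.mul_le_mul_left _ (by omega)
      have h3 : (if τ.g i i' = 0 then 0 else A i - ((i' : ℕ) + 1)) ≤
          (A i - (i' + 1)) * (if τ.g i i' = 0 then E else E + 1) := by
        split_ifs
        · exact Nat.zero_le _
        · exact Nat.le_mul_of_pos_right _ (by omega)
      simp only
      omega
  obtain ⟨i, hile, hi⟩ := hσ.inv.exists_lead
  have hdeg0 : ∀ t < ρ, (σ.g t t).natDegree ≤ (σ.g t t).natDegree ∧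
      (σ.g t ρ ≠ 0 → (σ.g t t).natDegree + 1 ≤ (σ.g t t).natDegree) :=
    fun t ht => ⟨le_rfl, fun h => absurd (hcol t ht) h⟩
  have hinit : ∃ n ≤ ∑ t ∈ Finset.Iio ρ, (((t : ℕ) + 2 + ρ * A t) * Δ +
      (A t - (ρ + 1)) * (Δ - 1)), R σ n := by
    rcases hile.lt_or_eq with hlt | rfl
    · obtain ⟨E, hE⟩ := hfresh _ hσ.inv i hi hlt
      refine ⟨_, ?_, hσ.row, hσ.inv, hdeg0, i, hile, hi, fun _ => ⟨E, hE, rfl⟩⟩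
      have h1 := hσ.excess_le one_pos hΔ hi.1
      have h2 : E + 1 ≤ Δ := by omega
      refine Finset.sum_le_sum fun t ht => ?_
      rw [if_pos (hcol t (Finset.mem_Iio.mp ht))]
      have h3 : (if t ≤ i then E + 1 else E) ≤ Δ := by split_ifs <;> omega
      exact Nat.add_le_add (Nat.mul_le_mul_left _ h3)
        (Nat.mul_le_mul_left _ (Nat.sub_le_sub_right h3 1))
    · exact ⟨0, Nat.zero_le _, hσ.row, hσ.inv, hdeg0, i, le_rfl, hi,
        fun h => absurd h (lt_irrefl _)⟩
  obtain ⟨n, hn, hRn⟩ := hinit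
  obtain ⟨k, n', h1, h2, h3⟩ := exists_iterate_step hstep σ n hRn
  exact ⟨k, h1.1, h1.2.1, h2, h3.trans (Nat.add_le_add_left hn _)⟩

end RowCost

end OnePointAG.AlgorithmG

namespace OnePointAG.AlgorithmG

/-! ### Numerical inequalities for the cost of a row. -/

section Estimates

theorem sum_Iio_fin {s : ℕ} (ρ : Fin s) (f : ℕ → ℕ) :
    ∑ t ∈ Finset.Iio ρ, f t = ∑ t ∈ Finset.range ρ, f t := by
  rw [← Nat.Iio_eq_range, ← Fin.map_valEmbedding_Iio, Finset.sum_map]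
  rfl

theorem two_mul_sum_sub_of_le {k m : ℕ} (h : k ≤ m) :
    2 * ∑ t ∈ Finset.range k, (m - t) + k * k = k * (2 * m + 1) := by
  induction k with
  | zero => simp
  | succ k ih =>
    have := ih (by omega)
    rw [Finset.sum_range_succ]
    obtain ⟨d, rfl⟩ := Nat.exists_eq_add_of_le h
    rw [show k + 1 + d - k = d + 1 by omega]
    linarith

theorem two_mul_sum_sub_of_ge {k m : ℕ} (h : m ≤ k) :
    2 * ∑ t ∈ Finset.range k, (m - t) = m * (m + 1) := by
  obtain ⟨e, rfl⟩ := Nat.exists_eq_add_of_le h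
  rw [Finset.sum_range_add, Finset.sum_eq_zero (s := Finset.range e) fun t _ => by omega, add_zero]
  linarith [two_mul_sum_sub_of_le (le_refl m)]

/-- The case `k ≤ m` of `unit_bound`, with `k + 1` for `k`, `m = k + 1 + d` and `H = u + v + 1`. In
such slack variables the difference of the two sides expands with nonnegative coefficients, once `H
≥ 2` has been used as `v ≥ 1` or `u ≥ 1`. -/
theorem unit_bound_of_le {k d u v : ℕ} (h : 2 ≤ u + (v + 1)) :
    (k + 1) * (v + 1) * ((k + 1) * (k + 4) + (k + 2) * ((u + v + 2) * ((k + 1) * (k + 2 * d + 2))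
      + u * ((k + 1) * k))) ≤ 2 * ((k + 1 + d) * (u + (v + 1))) ^ 2 * (k + 2) ^ 2 := by
  rcases Nat.eq_zero_or_pos u with rfl | hu
  · obtain ⟨v, rfl⟩ := Nat.exists_eq_add_of_le (show 1 ≤ v by omega)
    zify
    rw [← sub_nonneg]
    ring_nf
    positivity
  · obtain ⟨u, rfl⟩ := Nat.exists_eq_add_of_le hu
    zify
    rw [← sub_nonneg]
    ring_nf
    positivity

theorem unit_bound_of_ge {m e u v : ℕ} (h : 2 ≤ u + (v + 1)) :
    (m + 1) * (v + 1) * ((m + 1 + e) * (m + e + 4) + (m + e + 2) * ((u + v + 2) *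
      ((m + 1) * (m + 2)) + u * ((m + 1 + e) * (m + e)))) ≤
      2 * ((m + 1) * (u + (v + 1)) + u * e) ^ 2 * (m + e + 2) ^ 2 := by
  rcases Nat.eq_zero_or_pos u with rfl | hu
  · obtain ⟨v, rfl⟩ := Nat.exists_eq_add_of_le (show 1 ≤ v by omega)
    zify
    rw [← sub_nonneg]
    ring_nf
    positivity
  · obtain ⟨u, rfl⟩ := Nat.exists_eq_add_of_le hu
    zify
    rw [← sub_nonneg]
    ring_nf
    positivity

/-- The cost of a row, if `a₁ = 1` and `n + 2 g - 1 = 1`. -/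
theorem unit_bound_of_eq_one {k m S E T : ℕ} (hm : 0 < m) (hk : 0 < k) (hT : 2 * T = k * (k + 3))
    (hS : S ≤ 2 * ∑ t ∈ Finset.range k, (m - t)) (hE : 2 * m * E ≤ S * (2 * m - (k + 1))) :
    (T + k * S) * min k m + E * (min k m - 1) ≤ m ^ 2 * (k + 1) ^ 2 := by
  have key : ∀ {μ c S₀ : ℕ}, S ≤ S₀ → 2 * m - (k + 1) ≤ c →
      2 * m * μ * (k * (k + 3) + 2 * k * S₀) + 2 * (μ - 1) * (S₀ * c) ≤ 4 * m ^ 3 * (k + 1) ^ 2 →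
      (T + k * S) * μ + E * (μ - 1) ≤ m ^ 2 * (k + 1) ^ 2 := by
    intro μ c S₀ hS₀ hc h
    have h1 : 2 * m * E ≤ S₀ * c := hE.trans (Nat.mul_le_mul hS₀ hc)
    have h2 := Nat.mul_le_mul_left (2 * (μ - 1)) h1
    have h3 : 4 * m * μ * k * S ≤ 4 * m * μ * k * S₀ := Nat.mul_le_mul_left _ hS₀
    -- The factor `4 * m` clears the half in `hT` and the `2 * m` in `hE`.
    have h4 : 4 * m * ((T + k * S) * μ + E * (μ - 1)) ≤ 4 * m * (m ^ 2 * (k + 1) ^ 2) := by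
      have h5 : 4 * m * ((T + k * S) * μ + E * (μ - 1)) =
          2 * m * μ * (2 * T) + 4 * m * μ * k * S + 2 * (μ - 1) * (2 * m * E) := by ring
      rw [h5, hT]
      nlinarith
    exact Nat.le_of_mul_le_mul_left h4 (by omega)
  rcases le_or_gt k m with hkm | hkm
  · rw [min_eq_left hkm]
    obtain ⟨d, rfl⟩ := Nat.exists_eq_add_of_le hkm
    obtain ⟨k, rfl⟩ := Nat.exists_eq_add_of_le' hk
    refine key (S₀ := (k + 1) * (k + 2 * d + 2)) (c := k + 2 * d) ?_ (by omega) ?_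
    · have := two_mul_sum_sub_of_le hkm
      nlinarith
    · rw [Nat.add_sub_cancel]
      zify
      rw [← sub_nonneg]
      ring_nf
      positivity
  · rw [min_eq_right hkm.le]
    rw [two_mul_sum_sub_of_ge hkm.le] at hS
    obtain ⟨e, rfl⟩ := Nat.exists_eq_add_of_lt hkm
    -- Here `k = m + e + 1`; the cases tell whether `2 * m - (k + 1)` is truncated.
    rcases le_or_gt (e + 2) m with hem | hem
    · obtain ⟨f, rfl⟩ := Nat.exists_eq_add_of_le hem
      refine key (c := f) hS (by omega) ?_
      rw [show e + 2 + f - 1 = e + 1 + f by omega]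
      zify
      rw [← sub_nonneg]
      ring_nf
      positivity
    · refine key (c := 0) hS (by omega) ?_
      obtain ⟨m, rfl⟩ := Nat.exists_eq_add_of_le' hm
      zify
      rw [← sub_nonneg]
      ring_nf
      positivity

/-- The cost of a row, if `a₁ = 1`. -/
theorem unit_bound {k m u H W S E T : ℕ} (hu : u < H) (hW : m * H + u * (k - m) ≤ W)
    (hT : 2 * T = k * (k + 3))
    (hS : 2 * S ≤ (H + 1) * (2 * ∑ t ∈ Finset.range k, (m - t)) + u * (k * (k - 1)))
    (hES : E ≤ S) (hE : H = 1 → 2 * m * E ≤ S * (2 * m - (k + 1))) :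
    (T + k * S) * (min k m * (H - u)) + E * (min k m * (H - u) - 1) ≤ W ^ 2 * (k + 1) ^ 2 := by
  rcases Nat.eq_zero_or_pos (min k m) with h0 | h0
  · simp [h0]
  have hk : 0 < k := lt_of_lt_of_le h0 (min_le_left _ _)
  have hm : 0 < m := lt_of_lt_of_le h0 (min_le_right _ _)
  refine le_trans ?_ (Nat.mul_le_mul_right _ (Nat.pow_le_pow_left hW 2))
  -- For `H ≥ 2` the crude `E ≤ S` suffices; the finer `hE` serves `H = 1`, where `u = 0`.
  rcases Nat.lt_or_ge 1 H with hH | hH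
  · obtain ⟨v, rfl⟩ := Nat.exists_eq_add_of_lt hu
    rw [show u + v + 1 - u = v + 1 by omega]
    have key : ∀ {μ X : ℕ}, 2 * ∑ t ∈ Finset.range k, (m - t) = X →
        μ * (v + 1) * (k * (k + 3) + (k + 1) * ((u + v + 2) * X + u * (k * (k - 1)))) ≤
          2 * (m * (u + v + 1) + u * (k - m)) ^ 2 * (k + 1) ^ 2 →
        (T + k * S) * (μ * (v + 1)) + E * (μ * (v + 1) - 1) ≤
          (m * (u + v + 1) + u * (k - m)) ^ 2 * (k + 1) ^ 2 := by
      intro μ X hX h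
      rw [hX] at hS
      have h1 : E * (μ * (v + 1) - 1) ≤ S * (μ * (v + 1)) := Nat.mul_le_mul hES (Nat.sub_le _ _)
      have h2 : μ * (v + 1) * (2 * T + (k + 1) * (2 * S)) ≤
          μ * (v + 1) * (k * (k + 3) + (k + 1) * ((u + v + 2) * X + u * (k * (k - 1)))) := by
        rw [hT]
        gcongr
      have h3 : μ * (v + 1) * (2 * T + (k + 1) * (2 * S))
          = 2 * ((T + k * S) * (μ * (v + 1)) + S * (μ * (v + 1))) := by ring
      linarith
    rcases le_or_gt k m with hkm | hkm
    · rw [min_eq_left hkm]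
      have hX := two_mul_sum_sub_of_le hkm
      obtain ⟨d, rfl⟩ := Nat.exists_eq_add_of_le hkm
      obtain ⟨k, rfl⟩ := Nat.exists_eq_add_of_le' hk
      refine key (X := (k + 1) * (k + 2 * d + 2)) (by nlinarith) ?_
      have := unit_bound_of_le (k := k) (d := d) (u := u) (v := v) (by omega)
      rw [show k + 1 - (k + 1 + d) = 0 by omega, Nat.add_sub_cancel]
      simpa [add_assoc] using this
    · rw [min_eq_right hkm.le]
      have hX := two_mul_sum_sub_of_ge hkm.le
      obtain ⟨e, rfl⟩ := Nat.exists_eq_add_of_le hkm.le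
      obtain ⟨m, rfl⟩ := Nat.exists_eq_add_of_le' hm
      refine key hX ?_
      have := unit_bound_of_ge (m := m) (e := e) (u := u) (v := v) (by omega)
      rw [show m + 1 + e - (m + 1) = e by omega, show m + 1 + e - 1 = m + e by omega]
      refine le_trans (le_of_eq ?_) (this.trans (le_of_eq ?_)) <;> ring
  · obtain rfl : H = 1 := by omega
    obtain rfl : u = 0 := by omega
    have := unit_bound_of_eq_one hm hk hT (by omega) (hE rfl)
    simpa using this

/-- The cost of a row, if `a₁ ≥ 2`. -/
theorem bound_of_two_le {a ρ Δ V M W : ℕ} (ha : 2 ≤ a) (hρ : a ≤ ρ) (hΔ : Δ ≤ V)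
    (hM : M ≤ 2 * V + a - 1) (hW : V + a - 1 ≤ W) :
    a * ((1 + (ρ + 1) * (M / a + 1)) * (Δ * ((ρ + a - 1) / a))) ≤ W ^ 2 * (ρ + 1) ^ 2 := by
  obtain ⟨a, rfl⟩ := Nat.exists_eq_add_of_le' ha
  obtain ⟨r, rfl⟩ := Nat.exists_eq_add_of_le hρ
  set A := a + 2 with hA
  have h1 : A * ((A + r + A - 1) / A) ≤ A + r + A - 1 := Nat.mul_div_le _ _
  have h2 : A * (M / A) ≤ 2 * V + A - 1 := (Nat.mul_div_le _ _).trans hM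
  set c := (A + r + A - 1) / A
  set q := M / A
  -- A second factor `A` removes both integer divisions, in `c` and in `q`.
  have h3 : A * (A * ((1 + (A + r + 1) * (q + 1)) * (Δ * c))) ≤
      A * ((V + A - 1) ^ 2 * (A + r + 1) ^ 2) := by
    calc A * (A * ((1 + (A + r + 1) * (q + 1)) * (Δ * c)))
        = (A + (A + r + 1) * (A * q + A)) * (Δ * (A * c)) := by ring
      _ ≤ (A + (A + r + 1) * (2 * V + A - 1 + A)) * (V * (A + r + A - 1)) := by gcongr
      _ ≤ A * ((V + A - 1) ^ 2 * (A + r + 1) ^ 2) := by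
        rw [show 2 * V + A - 1 = 2 * V + a + 1 by omega,
          show A + r + A - 1 = 2 * a + r + 3 by omega, show V + A - 1 = V + a + 1 by omega, hA]
        zify
        rw [← sub_nonneg]
        ring_nf
        positivity
  refine (Nat.le_of_mul_le_mul_left h3 (by omega)).trans ?_
  gcongr

end Estimates

end OnePointAG.AlgorithmG

namespace OnePointAG

/-! ### Valuations, places and divisors. -/

section Valuation

variable {K F : Type*} [Field K] [Field F] [Algebra K F]

/-- The nonzero terms have distinct values, so the smallest value is attained once and is that of
the sum. -/
theorem addValuation_sum_le {ι : Type*} (v : AddValuation F (WithTop ℤ)) (s : Finset ι) (t : ι → F)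
    (h : ∀ i ∈ s, ∀ j ∈ s, t i ≠ 0 → t j ≠ 0 → v (t i) = v (t j) → i = j) {j : ι} (hj : j ∈ s) :
    v (∑ i ∈ s, t i) ≤ v (t j) := by
  classical
  by_cases hj0 : t j = 0
  · simp [hj0]
  obtain ⟨k, hk, hmin⟩ := s.exists_min_image (fun i => v (t i)) ⟨j, hj⟩
  have hk0 : v (t k) ≠ ⊤ := fun h0 => by
    have := hmin j hj
    simp only [h0, top_le_iff] at this
    exact hj0 (v.top_iff.mp this)
  refine le_trans (le_of_eq ?_) (hmin j hj)
  rw [← Finset.add_sum_erase s t hk]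
  apply v.map_add_eq_of_lt_left
  refine v.map_lt_sum hk0 fun i hi => ?_
  obtain ⟨hik, his⟩ := Finset.mem_erase.mp hi
  refine lt_of_le_of_ne (hmin i his) fun heq => hik ?_
  refine h i his k hk ?_ (v.ne_top_iff.mp hk0) heq.symm
  exact v.ne_top_iff.mp (heq ▸ hk0)

namespace Place

variable (P : Place K F)

theorem v_eq_ord {z : F} (hz : z ≠ 0) : P.v z = (P.ord z : WithTop ℤ) := by
  obtain ⟨n, hn⟩ := WithTop.ne_top_iff_exists.mp (P.v.ne_top_iff.mpr hz)
  rw [ord, ← hn]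
  rfl

theorem le_v_iff {z : F} (hz : z ≠ 0) {n : ℤ} : (n : WithTop ℤ) ≤ P.v z ↔ n ≤ P.ord z := by
  rw [P.v_eq_ord hz, WithTop.coe_le_coe]

theorem v_nonneg_iff {z : F} (hz : z ≠ 0) : 0 ≤ P.v z ↔ 0 ≤ P.ord z := by
  rw [← P.le_v_iff hz]; rfl

theorem v_pos_iff {z : F} (hz : z ≠ 0) : 0 < P.v z ↔ 0 < P.ord z := by
  rw [P.v_eq_ord hz, ← WithTop.coe_zero, WithTop.coe_lt_coe]

theorem ord_eq_iff {z : F} (hz : z ≠ 0) {n : ℤ} : P.ord z = n ↔ P.v z = (n : WithTop ℤ) := by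
  rw [P.v_eq_ord hz, WithTop.coe_eq_coe]

theorem ord_mul {x y : F} (hx : x ≠ 0) (hy : y ≠ 0) : P.ord (x * y) = P.ord x + P.ord y := by
  rw [P.ord_eq_iff (mul_ne_zero hx hy), P.v.map_mul, P.v_eq_ord hx, P.v_eq_ord hy, WithTop.coe_add]

theorem ord_one : P.ord (1 : F) = 0 := by
  rw [P.ord_eq_iff one_ne_zero, P.v.map_one]; rfl

theorem ord_pow {x : F} (hx : x ≠ 0) (n : ℕ) : P.ord (x ^ n) = n * P.ord x := by
  induction n with
  | zero => simp [P.ord_one]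
  | succ n ih => rw [pow_succ, P.ord_mul (pow_ne_zero n hx) hx, ih]; push_cast; ring

theorem ord_prod {ι : Type*} (s : Finset ι) (t : ι → F) (ht : ∀ i ∈ s, t i ≠ 0) :
    P.ord (∏ i ∈ s, t i) = ∑ i ∈ s, P.ord (t i) := by
  classical
  induction s using Finset.induction_on with
  | empty => simp [P.ord_one]
  | insert i s hi ih =>
    have h := fun j hj => ht j (Finset.mem_insert_of_mem hj)
    rw [Finset.prod_insert hi, Finset.sum_insert hi,
      P.ord_mul (ht i (Finset.mem_insert_self i s)) (Finset.prod_ne_zero_iff.mpr h), ih h]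

theorem ord_inv {x : F} (hx : x ≠ 0) : P.ord x⁻¹ = -P.ord x := by
  have h := P.ord_mul hx (inv_ne_zero hx)
  rw [mul_inv_cancel₀ hx, P.ord_one] at h
  omega

theorem v_smul {c : K} (hc : c ≠ 0) (z : F) : P.v (c • z) = P.v z := by
  rw [Algebra.smul_def, P.v.map_mul, P.trivial_on_constants c hc, zero_add]

variable {P}

theorem exists_sub_algebraMap_pos (hP : P.degree = 1) {z : F} (hz : 0 ≤ P.v z) :
    ∃ c : K, 0 < P.v (z - algebraMap K F c) := by
  have hone : (1 : F) ∈ P.valuationRing := by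
    change 0 ≤ P.v 1
    rw [P.v.map_one]
  set N := P.maxIdeal.submoduleOf P.valuationRing
  have hne : (Submodule.Quotient.mk ⟨1, hone⟩ : P.valuationRing ⧸ N) ≠ 0 := by
    rw [Ne, Submodule.Quotient.mk_eq_zero]
    intro h
    have h' : 0 < P.v 1 := h
    rw [P.v.map_one] at h'
    exact lt_irrefl _ h'
  obtain ⟨c, hc⟩ := (finrank_eq_one_iff_of_nonzero' _ hne).mp hP
    (Submodule.Quotient.mk ⟨z, hz⟩)
  refine ⟨c, ?_⟩
  rw [← Submodule.Quotient.mk_smul, Submodule.Quotient.eq] at hc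
  have h : 0 < P.v (c • (1 : F) - z) := hc
  rwa [P.v.map_sub_swap, ← Algebra.algebraMap_eq_smul_one] at h

theorem exists_lt_v_sub_smul (hP : P.degree = 1) {x y : F} (hx : x ≠ 0) (hy : y ≠ 0)
    (h : P.ord x = P.ord y) : ∃ c : K, P.v y < P.v (x - c • y) := by
  have hxy : x / y ≠ 0 := div_ne_zero hx hy
  have h0 : P.ord (x / y) = 0 := by
    rw [div_eq_mul_inv, P.ord_mul hx (inv_ne_zero hy), P.ord_inv hy, h]; ring
  obtain ⟨c, hc⟩ := exists_sub_algebraMap_pos hP ((P.v_nonneg_iff hxy).mpr h0.ge)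
  refine ⟨c, ?_⟩
  have h1 : x - c • y = (x / y - algebraMap K F c) * y := by
    rw [sub_mul, div_mul_cancel₀ _ hy, Algebra.smul_def]
  rw [h1, P.v.map_mul, P.v_eq_ord hy]
  rcases eq_or_ne (x / y - algebraMap K F c) 0 with h2 | h2
  · rw [h2, P.v.map_zero, top_add]; exact WithTop.coe_lt_top _
  · rw [P.v_eq_ord h2, ← WithTop.coe_add, WithTop.coe_lt_coe]
    have := (P.v_pos_iff h2).mp hc
    omega

end Place

theorem mem_regularAwayFrom {Q : Place K F} {z : F} :
    z ∈ regularAwayFrom Q ↔ ∀ P : Place K F, P ≠ Q → 0 ≤ P.v z := Iff.rfl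

theorem mem_riemannRochSpace {A : Divisor K F} {z : F} :
    z ∈ riemannRochSpace A ↔ ∀ P : Place K F, ((-(A P) : ℤ) : WithTop ℤ) ≤ P.v z := Iff.rfl

theorem mem_riemannRochSpace_single {Q : Place K F} {c : ℤ} {z : F} :
    z ∈ riemannRochSpace (Finsupp.single Q c) ↔
      z ∈ regularAwayFrom Q ∧ ((-c : ℤ) : WithTop ℤ) ≤ Q.v z := by
  classical
  rw [mem_riemannRochSpace, mem_regularAwayFrom]
  constructor
  · intro h
    refine ⟨fun P hP => ?_, by simpa using h Q⟩
    have := h P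
    rwa [Finsupp.single_eq_of_ne hP, neg_zero, WithTop.coe_zero] at this
  · rintro ⟨h1, h2⟩ P
    rcases eq_or_ne P Q with rfl | hP
    · simpa using h2
    · rw [Finsupp.single_eq_of_ne hP, neg_zero, WithTop.coe_zero]; exact h1 P hP

theorem divisorDegree_add (A B : Divisor K F) :
    divisorDegree (A + B) = divisorDegree A + divisorDegree B := by
  classical
  exact Finsupp.sum_add_index' (fun _ => by simp) fun _ _ _ => by ring

theorem divisorDegree_single (P : Place K F) (c : ℤ) :
    divisorDegree (Finsupp.single P c) = c * P.degree :=
  Finsupp.sum_single_index (by simp)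

theorem divisorDegree_sum {ι : Type*} (s : Finset ι) (A : ι → Divisor K F) :
    divisorDegree (∑ i ∈ s, A i) = ∑ i ∈ s, divisorDegree (A i) :=
  map_sum (AddMonoidHom.mk' divisorDegree divisorDegree_add) A s

end Valuation

/-! ### Consequences of the genus inequality. -/

section Genus

variable {K F : Type*} [Field K] [Field F] [Algebra K F] {g : ℕ} {Q : Place K F}

theorem IsGenus.le (hg : IsGenus K F g) (A : Divisor K F) :
    divisorDegree A - (Module.finrank K (riemannRochSpace A) : ℤ) + 1 ≤ g :=
  hg.2 ⟨A, rfl⟩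

/-- The genus inequality forces `finrank ≥ 1`, and `finrank` would be `0` in infinite dimension. -/
theorem IsGenus.finite_single (hg : IsGenus K F g) (hQ : Q.degree = 1) {c : ℤ} (hc : (g : ℤ) ≤ c) :
    Module.Finite K (riemannRochSpace (Finsupp.single Q c)) := by
  have h := hg.le (Finsupp.single Q c)
  rw [divisorDegree_single, hQ] at h
  apply Module.finite_of_finrank_pos
  omega

/-- Otherwise the powers of `z`, independent because their orders at `Q` differ, would all lie in
the finite-dimensional `L(gQ)`. -/
theorem IsGenus.eq_zero_of_v_pos (hg : IsGenus K F g) (hQ : Q.degree = 1) {z : F}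
    (hz : z ∈ regularAwayFrom Q) (hzQ : 0 < Q.v z) : z = 0 := by
  by_contra hz0
  have hpos := (Q.v_pos_iff hz0).mp hzQ
  have hmem : ∀ i : ℕ, z ^ i ∈ riemannRochSpace (Finsupp.single Q (g : ℤ)) := fun i => by
    rw [mem_riemannRochSpace_single]
    refine ⟨pow_mem hz i, ?_⟩
    rw [Q.le_v_iff (pow_ne_zero i hz0), Q.ord_pow hz0]
    have : 0 ≤ (i : ℤ) * Q.ord z := by positivity
    omega
  have := hg.finite_single hQ (le_refl (g : ℤ))
  have hli : LinearIndependent K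
      (fun i : ℕ => (⟨z ^ i, hmem i⟩ : riemannRochSpace (Finsupp.single Q (g : ℤ)))) := by
    apply LinearIndependent.of_comp (Submodule.subtype _)
    rw [linearIndependent_iff']
    intro s c hsum i hi
    by_contra hci
    have h1 := addValuation_sum_le Q.v s (fun i => c i • z ^ i) (fun i _ j _ hi0 hj0 hij => by
      have hci : c i ≠ 0 := fun h0 => hi0 (by simp [h0])
      have hcj : c j ≠ 0 := fun h0 => hj0 (by simp [h0])
      rw [Q.v_smul hci, Q.v_smul hcj, Q.v_eq_ord (pow_ne_zero i hz0),
        Q.v_eq_ord (pow_ne_zero j hz0), WithTop.coe_eq_coe, Q.ord_pow hz0, Q.ord_pow hz0] at hij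
      exact_mod_cast mul_right_cancel₀ hpos.ne' hij) hi
    have h2 : ∑ i ∈ s, c i • z ^ i = 0 := hsum
    rw [h2, Q.v.map_zero, top_le_iff, Q.v.top_iff] at h1
    exact (smul_ne_zero hci (pow_ne_zero i hz0)) h1
  have hfin := hli.finite
  exact not_finite ℕ

/-- A subspace that contains, for every pole order `k ≤ c`, an element of this pole order, contains
all of `L(cQ)`. -/
theorem IsGenus.mem_of_pole_orders (hg : IsGenus K F g) (hQ : Q.degree = 1) (T : Submodule K F)
    (c : ℕ) (hT : ∀ k ∈ weierstrassSemigroup Q, k ≤ c →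
      ∃ t ∈ T, t ∈ regularAwayFrom Q ∧ t ≠ 0 ∧ Q.ord t = -(k : ℤ))
    {z : F} (hz : z ∈ regularAwayFrom Q) (hzc : ((-(c : ℤ) : ℤ) : WithTop ℤ) ≤ Q.v z) : z ∈ T := by
  induction c generalizing z with
  | zero =>
    rcases eq_or_ne z 0 with rfl | hz0
    · exact T.zero_mem
    rw [Q.le_v_iff hz0] at hzc
    rcases lt_or_eq_of_le hzc with h | h
    · exact absurd (hg.eq_zero_of_v_pos hQ hz ((Q.v_pos_iff hz0).mpr (by simpa using h))) hz0
    · obtain ⟨t, htT, ht, ht0, hto⟩ := hT 0 ⟨z, hz, hz0, h.symm⟩ le_rfl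
      obtain ⟨d, hd⟩ := Place.exists_lt_v_sub_smul hQ hz0 ht0 (by rw [hto, ← h])
      rw [Q.v_eq_ord ht0, hto] at hd
      have h0 := hg.eq_zero_of_v_pos hQ (sub_mem hz (Subalgebra.smul_mem _ ht d))
        (by simpa using hd)
      rw [sub_eq_zero] at h0
      rw [h0]; exact T.smul_mem d htT
  | succ c ih =>
    have ih' := fun z => ih (z := z) fun k hk hkc => hT k hk (by omega)
    rcases eq_or_ne z 0 with rfl | hz0
    · exact T.zero_mem
    rw [Q.le_v_iff hz0] at hzc
    rcases lt_or_eq_of_le hzc with h | h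
    · exact ih' z hz ((Q.le_v_iff hz0).mpr (by push_cast at h; omega))
    · obtain ⟨t, htT, ht, ht0, hto⟩ := hT (c + 1) ⟨z, hz, hz0, h.symm⟩ le_rfl
      obtain ⟨d, hd⟩ := Place.exists_lt_v_sub_smul hQ hz0 ht0 (by rw [hto, ← h])
      rw [Q.v_eq_ord ht0, hto] at hd
      have h1 : z - d • t ∈ T := by
        rcases eq_or_ne (z - d • t) 0 with h0 | h0
        · rw [h0]; exact T.zero_mem
        refine ih' _ (sub_mem hz (Subalgebra.smul_mem _ ht d)) ?_
        rw [Q.v_eq_ord h0, WithTop.coe_lt_coe] at hd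
        rw [Q.le_v_iff h0]
        push_cast at hd
        omega
      have h2 := T.add_mem h1 (T.smul_mem d htT)
      rwa [sub_add_cancel] at h2

open Classical in
theorem IsGenus.finrank_le_card (hg : IsGenus K F g) (hQ : Q.degree = 1) (c : ℕ) :
    Module.finrank K (riemannRochSpace (Finsupp.single Q (c : ℤ))) ≤
      ((Finset.range (c + 1)).filter (· ∈ weierstrassSemigroup Q)).card := by
  have hex : ∀ k : ℕ, ∃ t : F, k ∈ weierstrassSemigroup Q →
      t ∈ regularAwayFrom Q ∧ t ≠ 0 ∧ Q.ord t = -(k : ℤ) := fun k => by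
    by_cases hk : k ∈ weierstrassSemigroup Q
    · obtain ⟨t, ht⟩ := hk
      exact ⟨t, fun _ => ht⟩
    · exact ⟨0, fun h => absurd h hk⟩
  choose t ht using hex
  set S := ((Finset.range (c + 1)).filter (· ∈ weierstrassSemigroup Q)).image t
  have hle : riemannRochSpace (Finsupp.single Q (c : ℤ)) ≤ Submodule.span K (S : Set F) := by
    intro z hz
    rw [mem_riemannRochSpace_single] at hz
    refine hg.mem_of_pole_orders hQ _ c (fun k hk hkc => ⟨t k, Submodule.subset_span ?_, ht k hk⟩)
      hz.1 hz.2
    exact Finset.mem_coe.mpr (Finset.mem_image_of_mem _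
      (Finset.mem_filter.mpr ⟨Finset.mem_range.mpr (by omega), hk⟩))
  exact (Submodule.finrank_mono hle).trans
    ((finrank_span_finset_le_card (R := K) S).trans Finset.card_image_le)

/-- The Weierstrass semigroup meets every residue class. -/
theorem IsGenus.exists_mem_modEq (hg : IsGenus K F g) (hQ : Q.degree = 1) {a : ℕ} (j : Fin a) :
    ∃ k ∈ weierstrassSemigroup Q, k ≡ j [MOD a] := by
  classical
  by_contra! hno
  have ha : 0 < a := j.pos
  -- The range `0, …, c` contains `g + 1` members of each class. If one class misses `H(Q)`, then
  -- `dim L(cQ) ≤ c - g`, against the genus inequality.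
  set c := a * (g + 1) - 1 with hc
  have hcpos : 0 < a * (g + 1) := by positivity
  have h1 := hg.le (Finsupp.single Q (c : ℤ))
  rw [divisorDegree_single, hQ] at h1
  have h2 := hg.finrank_le_card hQ c
  have h3 : (Finset.range (c + 1)).filter (· ∈ weierstrassSemigroup Q) ⊆
      Finset.range (c + 1) \ (Finset.range (g + 1)).image (fun t => (j : ℕ) + a * t) := by
    intro k hk
    obtain ⟨hk1, hk2⟩ := Finset.mem_filter.mp hk
    refine Finset.mem_sdiff.mpr ⟨hk1, fun hk3 => ?_⟩
    obtain ⟨t, -, rfl⟩ := Finset.mem_image.mp hk3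
    exact hno _ hk2 (by simp [Nat.ModEq])
  have h4 : (Finset.range (g + 1)).image (fun t => (j : ℕ) + a * t) ⊆ Finset.range (c + 1) := by
    intro k hk
    obtain ⟨t, ht, rfl⟩ := Finset.mem_image.mp hk
    rw [Finset.mem_range] at ht ⊢
    have : a * (t + 1) ≤ a * (g + 1) := Nat.mul_le_mul_left _ (by omega)
    have h6 := j.2
    rw [Nat.mul_succ] at this
    omega
  have h5 := Finset.card_le_card h3
  rw [Finset.card_sdiff_of_subset h4, Finset.card_image_of_injective, Finset.card_range,
    Finset.card_range] at h5
  · have h6 : g + 1 ≤ a * (g + 1) := Nat.le_mul_of_pos_left _ ha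
    omega
  · intro t t' htt
    simp only [Nat.add_left_cancel_iff] at htt
    exact Nat.eq_of_mul_eq_mul_left ha htt

/-- A function in `L(∞Q)` whose zeros are simple and of degree one has at most as many poles as
zeros. -/
theorem IsGenus.neg_ord_le (hg : IsGenus K F g) (hQ : Q.degree = 1) {n : ℕ} (P : Fin n → Place K F)
    (hPinj : Function.Injective P) (hPQ : ∀ i, P i ≠ Q) (hP : ∀ i, (P i).degree = 1) {f : F}
    (hf : f ∈ regularAwayFrom Q) (hfD : IsZeroDivisor f (∑ i, Finsupp.single (P i) 1)) :
    -(Q.ord f) ≤ n := by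
  classical
  obtain ⟨hf0, hord⟩ := hfD
  have hDP : ∀ i, (∑ i, Finsupp.single (P i) (1 : ℤ)) (P i) = 1 := fun i => by
    rw [Finsupp.finsetSum_apply, Finset.sum_eq_single i]
    · simp
    · intro j _ hji
      exact Finsupp.single_eq_of_ne fun h => hji (hPinj h.symm)
    · simp
  have hDR : ∀ R, (∀ i, P i ≠ R) → (∑ i, Finsupp.single (P i) (1 : ℤ)) R = 0 := fun R hR => by
    rw [Finsupp.finsetSum_apply]
    exact Finset.sum_eq_zero fun i _ => Finsupp.single_eq_of_ne (hR i).symm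
  by_contra! hlt
  set N := -(Q.ord f) with hN
  -- If `N > n`, the divisor `A` below has degree `c * (N - n) - 1 ≥ g + 1`. But `L(A) = 0`:
  -- dividing by `f ^ c` leaves a function without poles that vanishes at `Q`. This contradicts the
  -- genus inequality.
  set c : ℕ := g + 2 with hc
  set A : Divisor K F := Finsupp.single Q (c * N - 1) + ∑ i, Finsupp.single (P i) (-(c : ℤ)) with hA
  have hAsum : ∀ R, (∑ i, Finsupp.single (P i) (-(c : ℤ))) R
      = -(c : ℤ) * (∑ i, Finsupp.single (P i) (1 : ℤ)) R := fun R => by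
    rw [Finsupp.finsetSum_apply, Finsupp.finsetSum_apply, Finset.mul_sum]
    refine Finset.sum_congr rfl fun i _ => ?_
    rw [← smul_eq_mul, ← Finsupp.smul_apply, Finsupp.smul_single, smul_eq_mul, mul_one]
  have hbot : riemannRochSpace A = ⊥ := by
    rw [eq_bot_iff]
    intro z hz
    rw [Submodule.mem_bot]
    by_contra hz0
    have hz' : ∀ R : Place K F, -(A R) ≤ R.ord z := fun R => (R.le_v_iff hz0).mp (hz R)
    have hfc : (f ^ c)⁻¹ ≠ 0 := inv_ne_zero (pow_ne_zero c hf0)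
    have hordq : ∀ R : Place K F, R.ord (z * (f ^ c)⁻¹) = R.ord z - c * R.ord f := fun R => by
      rw [R.ord_mul hz0 hfc, R.ord_inv (pow_ne_zero c hf0), R.ord_pow hf0]; ring
    have hne := mul_ne_zero hz0 hfc
    refine hne (hg.eq_zero_of_v_pos hQ (fun R hR => ?_) ?_)
    · rw [R.v_nonneg_iff hne, hordq]
      have h1 := hz' R
      rw [hA, Finsupp.add_apply, hAsum, Finsupp.single_eq_of_ne hR, zero_add] at h1
      have h2 := hord R
      have h3 := (R.v_nonneg_iff hf0).mp (hf R hR)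
      rw [max_eq_left h3] at h2
      rw [h2] at h1
      linarith
    · rw [Q.v_pos_iff hne, hordq]
      have h1 := hz' Q
      rw [hA, Finsupp.add_apply, hAsum, Finsupp.single_eq_same, hDR Q hPQ] at h1
      have h2 : Q.ord f = -N := by omega
      rw [h2]
      linarith
  have h1 := hg.le A
  rw [hbot, finrank_bot, hA, divisorDegree_add, divisorDegree_single, divisorDegree_sum, hQ] at h1
  simp only [divisorDegree_single, hP, Finset.sum_const, Finset.card_univ, Fintype.card_fin,
    nsmul_eq_mul] at h1
  have h2 : (c : ℤ) * (N - n) ≥ c * 1 := mul_le_mul_of_nonneg_left (by omega) (by positivity)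
  have h3 : (c : ℤ) = g + 2 := by rw [hc]; push_cast; ring
  push_cast at h1
  nlinarith

end Genus

end OnePointAG

namespace OnePointAG.OnePointData

open Polynomial

variable {K F : Type*} [Field K] [Field F] [Algebra K F] (S : OnePointData K F)

/-! ### The basis `y j` of `L(∞Q)` over `K[x₁]`. -/

section StandardForm

theorem x_ne_zero (i : Fin (S.t + 1)) : S.x i ≠ 0 := (S.x_pole i).1

theorem ord_x (i : Fin (S.t + 1)) : S.Q.ord (S.x i) = -(S.a i : ℤ) := by
  have h := (S.x_pole i).2 S.Q
  rw [Finsupp.single_eq_same] at h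
  have := S.a_pos i
  omega

theorem x_mem (i : Fin (S.t + 1)) : S.x i ∈ regularAwayFrom S.Q := by
  intro P hP
  have h := (S.x_pole i).2 P
  rw [Finsupp.single_eq_of_ne hP] at h
  rw [P.v_nonneg_iff (S.x_ne_zero i)]
  omega

theorem mem_weierstrassSemigroup_iff {k : ℕ} :
    k ∈ weierstrassSemigroup S.Q ↔ ∃ M, S.expWeight M = k := by
  rw [← S.a_generate, SetLike.mem_coe, AddSubmonoid.mem_closure_range_iff_of_fintype]
  refine exists_congr fun M => ?_
  rw [expWeight, eq_comm, Finset.sum_congr rfl fun i _ => by rw [smul_eq_mul, mul_comm]]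

theorem zero_mem_weierstrassSemigroup : 0 ∈ weierstrassSemigroup S.Q :=
  S.mem_weierstrassSemigroup_iff.mpr ⟨0, by simp [expWeight]⟩

theorem b_le {j : Fin S.a₁} {k : ℕ} (hk : k ∈ weierstrassSemigroup S.Q) (hkj : k ≡ j [MOD S.a₁]) :
    S.b j ≤ k := Nat.sInf_le ⟨hk, hkj⟩

theorem b_eq_zero {j : Fin S.a₁} (hj : (j : ℕ) = 0) : S.b j = 0 :=
  Nat.le_zero.mp (S.b_le S.zero_mem_weierstrassSemigroup (by rw [hj]))

variable {S} {g : ℕ} (hg : IsGenus K F g)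

include hg

theorem b_mem (j : Fin S.a₁) : S.b j ∈ weierstrassSemigroup S.Q ∧ S.b j ≡ j [MOD S.a₁] := by
  obtain ⟨k, hk⟩ := hg.exists_mem_modEq S.degree_Q j
  exact Nat.sInf_mem (s := {k | k ∈ weierstrassSemigroup S.Q ∧ k ≡ j [MOD S.a₁]}) ⟨k, hk⟩

theorem isMinimalExponent_L (j : Fin S.a₁) : S.IsMinimalExponent j (S.L j) := by
  have hex : ∃ M, S.IsMinimalExponent j M := by
    set T : Set (Fin (S.t + 1) → ℕ) := {M | S.expWeight M = S.b j} with hT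
    have hfin : T.Finite := by
      refine (Set.finite_Iic fun _ => S.b j).subset fun M hM i => ?_
      have h1 : S.a i * M i ≤ S.expWeight M :=
        Finset.single_le_sum (f := fun i => S.a i * M i) (fun _ _ => Nat.zero_le _)
          (Finset.mem_univ i)
      rw [show S.expWeight M = S.b j from hM] at h1
      exact (Nat.le_mul_of_pos_left _ (S.a_pos i)).trans h1
    -- At fixed weight `≺` reverses the lexicographic order, so its minimum is the lexicographic
    -- maximum.
    obtain ⟨M, hM, hmax⟩ := Set.exists_max_image T (fun M => toLex M) hfin
      (S.mem_weierstrassSemigroup_iff.mp (b_mem hg j).1)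
    refine ⟨M, hM, fun N hN hNM => Or.inr ⟨by rw [hN, hM], ?_⟩⟩
    have hlt : toLex N < toLex M := lt_of_le_of_ne (hmax N hN) fun h => hNM (toLex.injective h)
    exact hlt
  rw [L, dif_pos hex]
  exact hex.choose_spec

/-- Lowering a positive first exponent would give a smaller element of the same class. Hence
omitting `x₁` from `y j` loses nothing, and its pole order is exactly `b j`. -/
theorem L_zero (j : Fin S.a₁) : S.L j 0 = 0 := by
  by_contra h0
  set M := S.L j
  have hM : S.expWeight M = S.b j := (isMinimalExponent_L hg j).1
  set M' := Function.update M 0 (M 0 - 1) with hM'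
  have h1 : S.expWeight M' + S.a₁ = S.expWeight M := by
    rw [expWeight, expWeight, Fin.sum_univ_succ, Fin.sum_univ_succ]
    have : ∀ i : Fin S.t, M' i.succ = M i.succ := fun i => by simp [hM']
    simp only [this]
    have h2 : M' 0 = M 0 - 1 := by simp [hM']
    rw [h2]
    obtain ⟨e, he⟩ := Nat.exists_eq_succ_of_ne_zero h0
    rw [he, Nat.succ_sub_one, Nat.mul_succ, a₁]
    omega
  have h2 := S.b_le (j := j) (S.mem_weierstrassSemigroup_iff.mpr ⟨M', rfl⟩) (by
    have h3 := (b_mem hg j).2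
    rw [← hM, ← h1] at h3
    simpa using h3)
  have h3 : 0 < S.a₁ := S.a_pos 0
  omega

omit hg in
theorem y_ne_zero (j : Fin S.a₁) : S.y j ≠ 0 :=
  Finset.prod_ne_zero_iff.mpr fun _ _ => pow_ne_zero _ (S.x_ne_zero _)

omit hg in
theorem y_mem (j : Fin S.a₁) : S.y j ∈ regularAwayFrom S.Q :=
  prod_mem fun _ _ => pow_mem (S.x_mem _) _

theorem ord_y (j : Fin S.a₁) : S.Q.ord (S.y j) = -(S.b j : ℤ) := by
  rw [y, S.Q.ord_prod _ _ fun i _ => pow_ne_zero _ (S.x_ne_zero _), ← (isMinimalExponent_L hg j).1,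
    expWeight, Fin.sum_univ_succ, L_zero hg j, mul_zero, zero_add, Nat.cast_sum,
    ← Finset.sum_neg_distrib]
  refine Finset.sum_congr rfl fun i _ => ?_
  rw [S.Q.ord_pow (S.x_ne_zero _), S.ord_x]
  push_cast
  ring

omit hg in
theorem v_aeval_x₁ {p : K[X]} (hp : p ≠ 0) :
    S.Q.v (aeval S.x₁ p) = ((-(S.a₁ * p.natDegree : ℤ) : ℤ) : WithTop ℤ) := by
  have hx := S.x_ne_zero 0
  have hordx := S.ord_x 0
  have hterm : ∀ i, p.coeff i ≠ 0 → S.Q.v (p.coeff i • S.x₁ ^ i)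
      = ((-(S.a₁ * i : ℤ) : ℤ) : WithTop ℤ) := fun i hi => by
    rw [S.Q.v_smul hi, S.Q.v_eq_ord (pow_ne_zero i hx), S.Q.ord_pow hx, hordx]
    congr 1
    ring
  have ha : (0 : ℤ) < S.a₁ := by exact_mod_cast S.a_pos 0
  rw [aeval_eq_sum_range]
  apply le_antisymm
  · rw [← hterm _ (leadingCoeff_ne_zero.mpr hp)]
    refine addValuation_sum_le S.Q.v _ _ (fun i _ j _ hi hj hij => ?_)
      (Finset.mem_range.mpr (Nat.lt_succ_self _))
    have hi' : p.coeff i ≠ 0 := fun h0 => hi (by simp [h0])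
    have hj' : p.coeff j ≠ 0 := fun h0 => hj (by simp [h0])
    rw [hterm i hi', hterm j hj', WithTop.coe_eq_coe, neg_inj] at hij
    exact_mod_cast mul_left_cancel₀ ha.ne' hij
  · refine S.Q.v.map_le_sum fun i hi => ?_
    by_cases h0 : p.coeff i = 0
    · simp [h0]
    · rw [hterm i h0, WithTop.coe_le_coe, neg_le_neg_iff]
      refine mul_le_mul_of_nonneg_left ?_ ha.le
      exact_mod_cast Nat.lt_succ_iff.mp (Finset.mem_range.mp hi)

omit hg in
theorem aeval_x₁_ne_zero {p : K[X]} (hp : p ≠ 0) : aeval S.x₁ p ≠ 0 := by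
  rw [← S.Q.v.ne_top_iff, v_aeval_x₁ hp]
  exact WithTop.coe_ne_top

omit hg in
theorem aeval_x₁_mem (p : K[X]) : aeval S.x₁ p ∈ regularAwayFrom S.Q := by
  rw [aeval_eq_sum_range]
  exact sum_mem fun i _ => Subalgebra.smul_mem _ (pow_mem (S.x_mem 0) i) _

theorem v_aeval_mul_y {p : K[X]} (hp : p ≠ 0) (j : Fin S.a₁) :
    S.Q.v (aeval S.x₁ p * S.y j)
      = ((-(S.a₁ * p.natDegree + S.b j : ℤ) : ℤ) : WithTop ℤ) := by
  rw [S.Q.v.map_mul, v_aeval_x₁ hp, S.Q.v_eq_ord (y_ne_zero j), ord_y hg, ← WithTop.coe_add]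
  congr 1
  ring

/-- The pole orders of the summands in a representation by the basis `y_j` are distinct, so that
they bound the pole order of the sum from below. -/
theorem v_sum_le (c : Fin S.a₁ → K[X]) {j : Fin S.a₁} (hj : c j ≠ 0) :
    S.Q.v (∑ j, aeval S.x₁ (c j) * S.y j)
      ≤ ((-(S.a₁ * (c j).natDegree + S.b j : ℤ) : ℤ) : WithTop ℤ) := by
  rw [← v_aeval_mul_y hg hj]
  refine addValuation_sum_le S.Q.v _ _ (fun i _ k _ hi hk hik => ?_) (Finset.mem_univ j)
  have hi' : c i ≠ 0 := fun h0 => hi (by simp [h0])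
  have hk' : c k ≠ 0 := fun h0 => hk (by simp [h0])
  rw [v_aeval_mul_y hg hi', v_aeval_mul_y hg hk', WithTop.coe_eq_coe, neg_inj] at hik
  have h1 : S.a₁ * (c i).natDegree + S.b i = S.a₁ * (c k).natDegree + S.b k := by exact_mod_cast hik
  -- Modulo `a₁` the pole order of a summand is its index.
  have h2 : S.b i ≡ S.b k [MOD S.a₁] := by
    have := congrArg (· % S.a₁) h1
    simpa [Nat.ModEq] using this
  have h3 := ((b_mem hg i).2.symm.trans h2).trans (b_mem hg k).2
  rw [Nat.ModEq, Nat.mod_eq_of_lt i.2, Nat.mod_eq_of_lt k.2] at h3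
  exact Fin.ext h3

/-- Every pole order is some `b j + a₁ * i`, and `x₁ ^ i * y j` attains it. -/
theorem exists_coord {z : F} (hz : z ∈ regularAwayFrom S.Q) :
    ∃ c : Fin S.a₁ → K[X], z = ∑ j, aeval S.x₁ (c j) * S.y j := by
  set φ : (Fin S.a₁ → K[X]) →ₗ[K] F := ∑ j, (LinearMap.mulRight K (S.y j)) ∘ₗ
    (aeval S.x₁).toLinearMap ∘ₗ LinearMap.proj j with hφ
  have hφc : ∀ c, φ c = ∑ j, aeval S.x₁ (c j) * S.y j := fun c => by simp [hφ]
  have hmem : z ∈ LinearMap.range φ := by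
    refine hg.mem_of_pole_orders S.degree_Q _ (-(S.Q.ord z)).toNat (fun k hk _ => ?_) hz ?_
    · set j : Fin S.a₁ := ⟨k % S.a₁, Nat.mod_lt _ (S.a_pos 0)⟩ with hj
      have hkj : k ≡ j [MOD S.a₁] := (Nat.mod_modEq k S.a₁).symm
      obtain ⟨i, hi⟩ := (Nat.modEq_iff_dvd' (S.b_le hk hkj)).mp ((b_mem hg j).2.trans hkj.symm)
      have hle := S.b_le hk hkj
      have hXi : (X ^ i : K[X]) ≠ 0 := pow_ne_zero i X_ne_zero
      refine ⟨aeval S.x₁ (X ^ i : K[X]) * S.y j, ⟨Pi.single j (X ^ i), ?_⟩,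
        mul_mem (aeval_x₁_mem _) (y_mem j), mul_ne_zero (aeval_x₁_ne_zero hXi) (y_ne_zero j), ?_⟩
      · rw [hφc, Finset.sum_eq_single j]
        · rw [Pi.single_eq_same]
        · intro l _ hl
          rw [Pi.single_eq_of_ne hl, map_zero, zero_mul]
        · simp
      · rw [S.Q.ord_eq_iff (mul_ne_zero (aeval_x₁_ne_zero hXi) (y_ne_zero j)), v_aeval_mul_y hg hXi,
          natDegree_X_pow]
        congr 1
        have : k = S.a₁ * i + S.b j := by omega
        rw [this]; push_cast; ring
    · rcases eq_or_ne z 0 with rfl | hz0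
      · simp
      · rw [S.Q.le_v_iff hz0]
        omega
  obtain ⟨c, hc⟩ := hmem
  exact ⟨c, by rw [← hc, hφc]⟩

theorem coord_spec {z : F} (hz : z ∈ regularAwayFrom S.Q) :
    z = ∑ j, aeval S.x₁ (S.coord z j) * S.y j := by
  rw [coord, dif_pos (exists_coord hg hz)]
  exact (exists_coord hg hz).choose_spec

theorem v_le_of_coord_ne_zero {z : F} (hz : z ∈ regularAwayFrom S.Q) {j : Fin S.a₁}
    (hj : S.coord z j ≠ 0) :
    S.Q.v z ≤ ((-(S.a₁ * (S.coord z j).natDegree + S.b j : ℤ) : ℤ) : WithTop ℤ) := by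
  conv_lhs => rw [coord_spec hg hz]
  exact v_sum_le hg _ hj

theorem coord_eq {z : F} (hz : z ∈ regularAwayFrom S.Q) {c : Fin S.a₁ → K[X]}
    (hc : z = ∑ j, aeval S.x₁ (c j) * S.y j) : S.coord z = c := by
  have h0 : ∑ j, aeval S.x₁ ((S.coord z - c) j) * S.y j = 0 := by
    simp only [Pi.sub_apply, map_sub, sub_mul, Finset.sum_sub_distrib]
    rw [← hc, ← coord_spec hg hz, sub_self]
  rw [← sub_eq_zero]
  ext1 j
  by_contra hj
  have h1 := v_sum_le hg (S.coord z - c) hj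
  rw [h0, S.Q.v.map_zero, top_le_iff] at h1
  exact WithTop.coe_ne_top h1

theorem coord_zero : S.coord 0 = 0 :=
  coord_eq hg (zero_mem _) (by simp)

theorem coord_aeval_mul_y (p : K[X]) (j : Fin S.a₁) :
    S.coord (aeval S.x₁ p * S.y j) = Pi.single j p := by
  refine coord_eq hg (mul_mem (aeval_x₁_mem _) (y_mem j)) ?_
  rw [Finset.sum_eq_single j]
  · rw [Pi.single_eq_same]
  · intro l _ hl
    rw [Pi.single_eq_of_ne hl, map_zero, zero_mul]
  · simp

end StandardForm

/-! ### Degrees and weights of the input vectors. -/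

section Generators

/-- One formula serves both kinds of generators, since `m - k` truncates to `0` for `k > m`. Of the
binomial coefficient `N` only its vanishing and its diagonal value matter. -/
theorem generator_coeff (f h : F) (m k k' : ℕ) (j : Fin S.a₁) :
    ∃ N : ℤ, (S.generator f h m k j).coeff k' = (N : F) * (h ^ (k - k') * (f ^ (m - k) * S.y j)) ∧
      (k < k' → N = 0) ∧ (m < k - k' → N = 0) ∧ (k' = k → N = 1) := by
  have hpow : ∀ n i : ℕ, ((X - C h : F[X]) ^ n).coeff i = (-h) ^ (n - i) * (n.choose i : F) :=
    fun n i => by rw [sub_eq_add_neg, ← C_neg, coeff_X_add_C_pow]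
  rw [generator]
  split_ifs with hkm
  · refine ⟨(-1) ^ (k - k') * (k.choose k' : ℤ), ?_, fun hlt => ?_, fun hlt => by omega,
      fun heq => ?_⟩
    · rw [coeff_mul_C, hpow, neg_pow]
      push_cast
      ring
    · rw [Nat.choose_eq_zero_of_lt hlt]; simp
    · subst heq; simp
  · rw [mul_assoc, coeff_X_pow_mul']
    split_ifs with hk'
    · refine ⟨(-1) ^ (k - k') * (m.choose (k' - (k - m)) : ℤ), ?_, fun hlt => ?_, fun hlt => ?_,
        fun heq => ?_⟩
      · rw [coeff_mul_C, hpow, neg_pow, Nat.sub_eq_zero_of_le (not_le.mp hkm).le, pow_zero, one_mul]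
        rcases le_or_gt k' k with h1 | h1
        · rw [show m - (k' - (k - m)) = k - k' by omega]
          push_cast
          ring
        · rw [Nat.choose_eq_zero_of_lt (show m < k' - (k - m) by omega)]
          simp
      · rw [Nat.choose_eq_zero_of_lt (show m < k' - (k - m) by omega)]; simp
      · omega
      · subst heq
        rw [show k' - (k' - m) = m by omega]
        simp
    · exact ⟨0, by simp, fun _ => rfl, fun _ => rfl, fun _ => by omega⟩

variable {S} {g : ℕ} (hg : IsGenus K F g)

include hg

variable {p : K[X]} {h : F} {m ℓ : ℕ}

theorem generatorVectors_self (r : Fin ((ℓ + 1) * S.a₁)) :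
    S.generatorVectors (aeval S.x₁ p) h m ℓ r r = p ^ (m - r.divNat) := by
  obtain ⟨N, hN, -, -, h1⟩ := S.generator_coeff (aeval S.x₁ p) h m r.divNat r.divNat r.modNat
  rw [generatorVectors, hN, h1 rfl, Nat.sub_self, pow_zero, one_mul, Int.cast_one, one_mul,
    ← map_pow, coord_aeval_mul_y hg, Pi.single_eq_same]

theorem generatorVectors_of_lt {r r' : Fin ((ℓ + 1) * S.a₁)} (hr : r < r') :
    S.generatorVectors (aeval S.x₁ p) h m ℓ r r' = 0 := by
  obtain ⟨N, hN, h0, -, h1⟩ := S.generator_coeff (aeval S.x₁ p) h m r.divNat r'.divNat r.modNat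
  rw [generatorVectors, hN]
  have hle : (r.divNat : ℕ) ≤ r'.divNat := Nat.div_le_div_right (Fin.lt_def.mp hr).le
  rcases hle.lt_or_eq with hlt | heq
  · rw [h0 hlt]
    simp [coord_zero hg]
  · rw [h1 heq.symm, heq, Nat.sub_self, pow_zero, one_mul, Int.cast_one, one_mul, ← map_pow,
      coord_aeval_mul_y hg, Pi.single_eq_of_ne]
    intro hmod
    have h2 : (r : ℕ) / S.a₁ = r' / S.a₁ := heq
    have h3 : (r' : ℕ) % S.a₁ = r % S.a₁ := congrArg Fin.val hmod
    have h4 := Nat.div_add_mod (r : ℕ) S.a₁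
    have h5 := Nat.div_add_mod (r' : ℕ) S.a₁
    rw [h2, ← h3, h5] at h4
    exact (Fin.lt_def.mp hr).ne h4.symm

/-- The summands in the basis `y j` have distinct pole orders, so none exceeds the pole order of the
coefficient, which is read off from `generator_coeff`. -/
theorem generatorVectors_weight_le {H : ℕ} (hp : p ≠ 0) (hh : h ∈ regularAwayFrom S.Q)
    (hH : ((-(H : ℤ) : ℤ) : WithTop ℤ) ≤ S.Q.v h) {r r' : Fin ((ℓ + 1) * S.a₁)}
    (hr : S.generatorVectors (aeval S.x₁ p) h m ℓ r r' ≠ 0) :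
    (r'.divNat : ℕ) ≤ r.divNat ∧ (r.divNat : ℕ) - r'.divNat ≤ m ∧
      (S.generatorVectors (aeval S.x₁ p) h m ℓ r r').natDegree * S.a₁ + S.b r'.modNat ≤
        (r.divNat - r'.divNat) * H + (m - r.divNat) * (S.a₁ * p.natDegree) + S.b r.modNat := by
  obtain ⟨N, hN, h0, h0', -⟩ := S.generator_coeff (aeval S.x₁ p) h m r.divNat r'.divNat r.modNat
  have hN0 : N ≠ 0 := by
    rintro rfl
    apply hr
    rw [generatorVectors, hN]
    simp [coord_zero hg]
  refine ⟨not_lt.mp fun hlt => hN0 (h0 hlt), not_lt.mp fun hlt => hN0 (h0' hlt), ?_⟩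
  rw [generatorVectors, hN] at hr ⊢
  set e := (r.divNat : ℕ) - r'.divNat
  set d := m - (r.divNat : ℕ)
  have hNmem : (N : F) ∈ regularAwayFrom S.Q := intCast_mem _ N
  have hv := v_le_of_coord_ne_zero hg (mul_mem hNmem (mul_mem (pow_mem hh e)
    (mul_mem (pow_mem (aeval_x₁_mem p) d) (y_mem r.modNat)))) hr
  have hlow : ((-((e * H + d * (S.a₁ * p.natDegree) + S.b r.modNat : ℕ) : ℤ) : ℤ) : WithTop ℤ)
      ≤ S.Q.v ((N : F) * (h ^ e * (aeval S.x₁ p ^ d * S.y r.modNat))) := by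
    have h1 : 0 ≤ S.Q.v (N : F) := by
      rw [← map_intCast (algebraMap K F)]; exact S.Q.v_algebraMap_nonneg _
    have h2 : ((-(e * H : ℤ) : ℤ) : WithTop ℤ) ≤ S.Q.v (h ^ e) := by
      rcases eq_or_ne h 0 with rfl | hh0
      · rcases Nat.eq_zero_or_pos e with he | he
        · simp [he]
        · rw [zero_pow he.ne', S.Q.v.map_zero]; exact le_top
      · rw [S.Q.le_v_iff hh0] at hH
        rw [S.Q.le_v_iff (pow_ne_zero e hh0), S.Q.ord_pow hh0]
        nlinarith
    have h3 : S.Q.v (aeval S.x₁ p ^ d * S.y r.modNat)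
        = ((-((d * (S.a₁ * p.natDegree) + S.b r.modNat : ℕ) : ℤ) : ℤ) : WithTop ℤ) := by
      rw [← map_pow, v_aeval_mul_y hg (pow_ne_zero d hp), natDegree_pow]
      congr 1
      push_cast
      ring
    rw [S.Q.v.map_mul, S.Q.v.map_mul, h3]
    refine le_trans ?_ (add_le_add h1 (add_le_add_left h2 _))
    rw [zero_add, ← WithTop.coe_add, WithTop.coe_le_coe]
    push_cast
    linarith
  have h4 := hlow.trans hv
  rw [WithTop.coe_le_coe] at h4
  push_cast at h4
  zify
  linarith

end Generators

end OnePointAG.OnePointData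

namespace OnePointAG.AlgorithmG

open Polynomial

variable {K : Type*} [Field K]

/-! ### The total cost in terms of weights. -/

section WeightedBlocks

/-- Weights of the entries of a row, if `u` is less than the pole order bound `H`. -/
theorem weight_le_of_lt {H u m ℓ k k' D b B : ℕ} (hu : u < H) (hkl : k ≤ ℓ) (hml : m ≤ ℓ)
    (hk' : k' ≤ k) (hkm : k - k' ≤ m) (hD : D ≤ H + 1) (hb : b ≤ B) :
    (k - k') * H + (m - k) * D + b + k' * u ≤ B + m * (H + 1) + u * (ℓ - m) := by
  obtain ⟨e, rfl⟩ := Nat.exists_eq_add_of_le hk'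
  rw [Nat.add_sub_cancel_left] at hkm ⊢
  rcases le_or_gt (k' + e) m with h | h
  · obtain ⟨d, rfl⟩ := Nat.exists_eq_add_of_le h
    rw [Nat.add_sub_cancel_left]
    have h1 : d * D ≤ d * (H + 1) := Nat.mul_le_mul_left _ hD
    have h2 : k' * u ≤ k' * H := Nat.mul_le_mul_left _ hu.le
    nlinarith [Nat.zero_le (u * (ℓ - (k' + e + d)))]
  · rw [Nat.sub_eq_zero_of_le h.le, zero_mul, add_zero]
    obtain ⟨d, rfl⟩ := Nat.exists_eq_add_of_le hkm
    obtain ⟨c, hc⟩ := Nat.exists_eq_add_of_lt h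
    obtain ⟨i, hi⟩ := Nat.exists_eq_add_of_le hkl
    have hk'' : k' = d + c + 1 := by omega
    have hl : ℓ - (e + d) = c + 1 + i := by omega
    rw [hl, hk'']
    have h2 : d * u ≤ d * H := Nat.mul_le_mul_left _ hu.le
    nlinarith [Nat.zero_le (u * i)]

/-- The gain over `k * u` is at most `(k - k') * (H - u)`, and `k - k' ≤ min k m`. This is the
source of `Δ`. -/
theorem mul_add_mul_le {H u m k k' : ℕ} (hk' : k' ≤ k) (hkm : k - k' ≤ m) :
    (k - k') * H + k' * u ≤ k * u + min k m * (H - u) := by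
  obtain ⟨e, rfl⟩ := Nat.exists_eq_add_of_le hk'
  rw [Nat.add_sub_cancel_left] at hkm ⊢
  rcases le_or_gt H u with h | h
  · have : e * H ≤ e * u := Nat.mul_le_mul_left _ h
    nlinarith [Nat.zero_le (min (k' + e) m * (H - u))]
  · obtain ⟨v, rfl⟩ := Nat.exists_eq_add_of_le h.le
    rw [Nat.add_sub_cancel_left]
    have : e * v ≤ min (k' + e) m * v := Nat.mul_le_mul_right _ (le_min (by omega) hkm)
    nlinarith

variable {a ℓ m u H B d : ℕ} {b : Fin a → ℕ}
  {G : Fin ((ℓ + 1) * a) → Fin ((ℓ + 1) * a) → K[X]}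

/-- The degrees and weights of the input vectors of the algorithm. -/
structure InputWeights (a ℓ m H d : ℕ) (b : Fin a → ℕ)
    (G : Fin ((ℓ + 1) * a) → Fin ((ℓ + 1) * a) → K[X]) : Prop where
  lower : ∀ r r', r < r' → G r r' = 0
  diag_ne : ∀ r, G r r ≠ 0
  diag_deg : ∀ r, (G r r).natDegree = (m - r.divNat) * d
  weight_le : ∀ r r', G r r' ≠ 0 → (r'.divNat : ℕ) ≤ r.divNat ∧ (r.divNat : ℕ) - r'.divNat ≤ m ∧
    (G r r').natDegree * a + b r'.modNat ≤
      (r.divNat - r'.divNat) * H + (m - r.divNat) * (a * d) + b r.modNat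

/-- The weight of the basis element with index `i = j + k a`. -/
def blockWeight (u : ℕ) (b : Fin a → ℕ) (i : Fin ((ℓ + 1) * a)) : ℕ := b i.modNat + i.divNat * u

theorem InputWeights.entry_le (h : InputWeights a ℓ m H d b G) (r r' : Fin ((ℓ + 1) * a))
    (hr : G r r' ≠ 0) :
    (G r r').natDegree * a + blockWeight u b r' ≤
      blockWeight u b r + a * (G r r).natDegree + min (r.divNat : ℕ) m * (H - u) := by
  obtain ⟨h1, h2, h3⟩ := h.weight_le r r' hr
  have h4 := mul_add_mul_le (H := H) (u := u) h1 h2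
  rw [h.diag_deg, blockWeight, blockWeight]
  nlinarith

theorem InputWeights.weight_le_of_lt (h : InputWeights a ℓ m H d b G) (hu : u < H) (hml : m ≤ ℓ)
    (hd : a * d ≤ H + 1) (hB : ∀ j, b j ≤ B) (r r' : Fin ((ℓ + 1) * a)) (hr : G r r' ≠ 0) :
    (G r r').natDegree * a + blockWeight u b r' ≤ B + m * (H + 1) + u * (ℓ - m) := by
  obtain ⟨h1, h2, h3⟩ := h.weight_le r r' hr
  have h4 := AlgorithmG.weight_le_of_lt hu (Nat.lt_succ_iff.mp r.divNat.2) hml h1 h2 hd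
    (hB r.modNat)
  rw [blockWeight]
  omega

theorem blockWeight_residue (hb : ∀ j, b j ≡ j [MOD a]) {i j : Fin ((ℓ + 1) * a)} (hij : i < j)
    (hdvd : (a : ℤ) ∣ (blockWeight u b j : ℤ) - blockWeight u b i) :
    (i.divNat : ℕ) < j.divNat := by
  have hle : (i.divNat : ℕ) ≤ j.divNat := Nat.div_le_div_right (Fin.lt_def.mp hij).le
  refine lt_of_le_of_ne hle fun heq => ?_
  have h1 : blockWeight u b i ≡ blockWeight u b j [MOD a] := (Nat.modEq_iff_dvd).mpr hdvd
  rw [blockWeight, blockWeight, heq] at h1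
  have h2 := Nat.ModEq.add_right_cancel' _ h1
  have h3 := ((hb i.modNat).symm.trans h2).trans (hb j.modNat)
  rw [Nat.ModEq, Nat.mod_eq_of_lt i.modNat.2, Nat.mod_eq_of_lt j.modNat.2] at h3
  have h4 : (i : ℕ) / a = j / a := heq
  have h5 : (i : ℕ) % a = j % a := h3
  have h6 := Nat.div_add_mod (i : ℕ) a
  rw [h4, h5, Nat.div_add_mod] at h6
  exact (Fin.lt_def.mp hij).ne h6.symm

theorem InputWeights.halts_of_row_bound (h : InputWeights a ℓ m H d b G) (ha : 0 < a)
    (hb : ∀ j, b j ≡ j [MOD a]) {M : ℕ}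
    (hM : ∀ r r', G r r' ≠ 0 → (G r r').natDegree * a + blockWeight u b r' ≤ M) :
    ∃ N ≤ ∑ ρ : Fin ((ℓ + 1) * a), (1 + ((ρ : ℕ) + 1) * (M / a + 1)) *
        (min (ρ.divNat : ℕ) m * (H - u) * ((ρ + a - 1) / a)),
      HaltsWithMultiplications (a : ℤ) (fun i => (blockWeight u b i : ℤ)) G N := by
  have ha' : (0 : ℤ) < a := by exact_mod_cast ha
  refine halts_of_row_cost (M := M) ha' h.lower h.diag_ne
    (fun r r' hr => by exact_mod_cast hM r r' hr) _ fun ρ σ hσ _ => ?_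
  refine row_cost_le_of_residues ha' (fun i => (i.divNat : ℕ))
    (fun i j hij hdvd => blockWeight_residue hb hij hdvd) (fun i hi => ?_) (fun g hg i hi => ?_)
    (fun j hj => by exact_mod_cast h.entry_le ρ j hj) σ hσ
  -- `(ρ + a - 1) / a` is `ρ / a` rounded up, the number of blocks met by the indices below `ρ`.
  · have h1 : (i : ℕ) + a ≤ ρ + a - 1 := by have := Fin.lt_def.mp hi; omega
    have h2 := Nat.div_le_div_right (c := a) h1
    rw [Nat.add_div_right _ ha] at h2
    exact h2
  · gcongr
    exact denseSize_le_of_weight_le ha (fun j => by positivity)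
      (fun j hj => hg.supp i hi.le j hj) (fun j hj => hg.bound i hi.le j hj)

/-- The case `u ≥ n + 2 g - 1`: the input is already a Gröbner basis. -/
theorem InputWeights.halts_zero (h : InputWeights a ℓ m H d b G) (ha : 0 < a)
    (hb : ∀ j, b j ≡ j [MOD a]) (hu : H ≤ u) :
    HaltsWithMultiplications (a : ℤ) (fun i => (blockWeight u b i : ℤ)) G 0 := by
  -- Any weight bound `M` will do, since `H - u = 0` leaves no replacement to pay for.
  obtain ⟨N, hN, hhalt⟩ := h.halts_of_row_bound (u := u) ha hb
    (M := ∑ r, ∑ r', ((G r r').natDegree * a + blockWeight u b r')) fun r r' _ =>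
      (Finset.single_le_sum (f := fun r' => (G r r').natDegree * a + blockWeight u b r')
        (fun _ _ => Nat.zero_le _) (Finset.mem_univ r')).trans
      (Finset.single_le_sum (f := fun r => ∑ r', ((G r r').natDegree * a + blockWeight u b r'))
        (fun _ _ => Nat.zero_le _) (Finset.mem_univ r))
  rw [Nat.sub_eq_zero_of_le hu] at hN
  simp only [mul_zero, zero_mul, Finset.sum_const_zero] at hN
  rwa [Nat.le_zero.mp hN] at hhalt

theorem InputWeights.halts_of_two_le (h : InputWeights a ℓ m H d b G) (ha : 2 ≤ a)
    (hb : ∀ j, b j ≡ j [MOD a]) (hB : ∀ j, b j ≤ B) (hml : m ≤ ℓ) (hd : a * d ≤ H + 1)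
    (hu : u < H) :
    ∃ N, HaltsWithMultiplications (a : ℤ) (fun i => (blockWeight u b i : ℤ)) G N ∧
      a * N ≤ ∑ ρ : Fin ((ℓ + 1) * a), (B + m * H + u * (ℓ - m)) ^ 2 * ((ρ : ℕ) + 1) ^ 2 := by
  obtain ⟨N, hN, hhalt⟩ := h.halts_of_row_bound (u := u) (by omega) hb
    (h.weight_le_of_lt hu hml hd hB)
  refine ⟨N, hhalt, (Nat.mul_le_mul_left a hN).trans ?_⟩
  rw [Finset.mul_sum]
  refine Finset.sum_le_sum fun ρ _ => ?_
  rcases Nat.eq_zero_or_pos (min (ρ.divNat : ℕ) m) with h0 | h0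
  · rw [h0]; simp
  have hρ : a ≤ ρ := by
    have h1 : 0 < (ρ.divNat : ℕ) := lt_of_lt_of_le h0 (min_le_left _ _)
    have h2 : 0 < (ρ : ℕ) / a := h1
    exact (Nat.div_pos_iff.mp h2).2
  have hBa : a - 1 ≤ B := by
    refine le_trans ?_ (hB ⟨a - 1, by omega⟩)
    have h1 := hb ⟨a - 1, by omega⟩
    rw [Nat.ModEq, Nat.mod_eq_of_lt (show ((⟨a - 1, _⟩ : Fin a) : ℕ) < a from Fin.is_lt _)] at h1
    exact h1.symm.le.trans (Nat.mod_le _ _)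
  have hmH : m ≤ m * H := Nat.le_mul_of_pos_right _ (by omega)
  -- Since `B ≥ a - 1`, this `V` is at least `m * H`, hence at least `m`. So the weight bound, which
  -- is `V + a - 1 + m`, is at most `2 * V + a - 1`.
  refine bound_of_two_le (V := B + m * H + u * (ℓ - m) - (a - 1)) ha hρ ?_ ?_ ?_
  · have : min (ρ.divNat : ℕ) m * (H - u) ≤ m * H :=
      Nat.mul_le_mul (min_le_right _ _) (Nat.sub_le _ _)
    omega
  · rw [Nat.mul_succ]
    omega
  · omega

theorem two_mul_sum_add_two (k : ℕ) : 2 * ∑ t ∈ Finset.range k, (t + 2) = k * (k + 3) := by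
  induction k with
  | zero => simp
  | succ k ih => rw [Finset.sum_range_succ, mul_add, ih]; ring

theorem InputWeights.halts_of_eq_one {b : Fin 1 → ℕ}
    {G : Fin ((ℓ + 1) * 1) → Fin ((ℓ + 1) * 1) → K[X]} (h : InputWeights 1 ℓ m H d b G)
    (hb : ∀ j, b j = 0) (hml : m ≤ ℓ) (hd : 1 * d ≤ H + 1) (hu : u < H) :
    ∃ N, HaltsWithMultiplications 1 (fun i => (blockWeight u b i : ℤ)) G N ∧
      N ≤ ∑ ρ : Fin ((ℓ + 1) * 1), (m * H + u * (ℓ - m)) ^ 2 * ((ρ : ℕ) + 1) ^ 2 := by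
  have hdiv : ∀ r : Fin ((ℓ + 1) * 1), (r.divNat : ℕ) = r := fun r => Nat.div_one _
  have hwt : ∀ r : Fin ((ℓ + 1) * 1), blockWeight u b r = r * u := fun r => by
    rw [blockWeight, hb, hdiv, zero_add]
  set M := m * (H + 1) + u * (ℓ - m) with hMdef
  have hM : ∀ r r', G r r' ≠ 0 → (G r r').natDegree * 1 + blockWeight u b r' ≤ M := fun r r' hr => by
    have := h.weight_le_of_lt (B := 0) hu hml hd (fun j => (hb j).le) r r' hr
    omega
  obtain ⟨N, hN, hhalt⟩ := halts_of_row_cost (ux := 1) (w := fun i => (blockWeight u b i : ℤ))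
    (M := M) one_pos h.lower h.diag_ne (fun r r' hr => by exact_mod_cast hM r r' hr)
    (fun ρ => (m * H + u * (ℓ - m)) ^ 2 * ((ρ : ℕ) + 1) ^ 2) (fun ρ σ hσ hcol => by
      obtain ⟨k, h1, h2, h3, h4⟩ := row_cost_le_of_weights
        (Δ := min (ρ.divNat : ℕ) m * (H - u))
        (fun j hj => by exact_mod_cast h.entry_le ρ j hj) σ hσ hcol
      refine ⟨k, h1, h2, h3, h4.trans (Nat.add_le_add_left ?_ _)⟩
      set A : Fin ((ℓ + 1) * 1) → ℕ := fun t => (σ.g t t).natDegree + blockWeight u b t with hA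
      change ∑ t ∈ Finset.Iio ρ, (((t : ℕ) + 2 + ρ * A t) * _ + (A t - (ρ + 1)) * _) ≤ _
      rw [Finset.sum_add_distrib, ← Finset.sum_mul, ← Finset.sum_mul, Finset.sum_add_distrib,
        ← Finset.mul_sum, hdiv, sum_Iio_fin ρ fun t => t + 2]
      -- Here `T`, `S`, `E` are the sums over `t < ρ` of `t + 2`, `A t` and `A t - (ρ + 1)`.
      refine unit_bound hu ?_ (two_mul_sum_add_two _) ?_ ?_ ?_
      · have : (ρ : ℕ) ≤ ℓ := by have := ρ.2; omega
        gcongr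
      · have h5 : ∑ t ∈ Finset.Iio ρ, (σ.g t t).natDegree
            ≤ (∑ t ∈ Finset.range ρ, (m - t)) * (H + 1) := by
          refine hσ.sum_diag.trans ?_
          rw [← sum_Iio_fin ρ fun t => m - t, Finset.sum_mul]
          refine Finset.sum_le_sum fun t _ => ?_
          rw [h.diag_deg, hdiv]
          exact Nat.mul_le_mul_left _ (by omega)
        have h6 : ∑ t ∈ Finset.Iio ρ, blockWeight u b t * 2 = ρ * (ρ - 1) * u := by
          rw [Finset.sum_congr rfl fun t _ => by rw [hwt t], sum_Iio_fin ρ fun t => t * u * 2,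
            ← Finset.sum_range_id_mul_two, Finset.sum_mul, Finset.sum_mul]
          exact Finset.sum_congr rfl fun t _ => by ring
        rw [← Finset.sum_mul] at h6
        rw [hA, Finset.sum_add_distrib]
        nlinarith
      · exact Finset.sum_le_sum fun t _ => Nat.sub_le _ _
      · rintro rfl
        obtain rfl : u = 0 := by omega
        rw [Finset.mul_sum, Finset.sum_mul]
        refine Finset.sum_le_sum fun t ht => ?_
        have hlt := Finset.mem_Iio.mp ht
        -- For `H = 1` and `u = 0` the uniform weight bound is `2 * m`. As `(A - (ρ + 1)) / A` grows
        -- with `A`, its value at `2 * m` bounds every term.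
        have h5 : A t ≤ 2 * m := by
          have h6 := hσ.inv.bound t hlt.le t (hσ.inv.lead t hlt).1
          have h7 : (σ.g t t).natDegree * 1 + blockWeight 0 b t ≤ M := by exact_mod_cast h6
          simp only [hA]
          omega
        rcases le_or_gt (A t) (ρ + 1) with h6 | h6
        · rw [Nat.sub_eq_zero_of_le h6, mul_zero]; exact Nat.zero_le _
        · obtain ⟨e, he⟩ := Nat.exists_eq_add_of_le h6.le
          obtain ⟨f, hf⟩ := Nat.exists_eq_add_of_le h5
          rw [hf, he, Nat.add_sub_cancel_left, add_assoc ((ρ : ℕ) + 1) e f, Nat.add_sub_cancel_left]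
          nlinarith)
  exact ⟨N, hhalt, hN⟩

/-- Termination and the number of multiplications for input vectors with the given weights. -/
theorem InputWeights.exists_halts (h : InputWeights a ℓ m H d b G) (ha : 0 < a)
    (hb : ∀ j, b j ≡ j [MOD a]) (hb₀ : ∀ j : Fin a, (j : ℕ) = 0 → b j = 0) (hB : ∀ j, b j ≤ B)
    (hml : m ≤ ℓ) (hd : a * d ≤ H + 1) :
    ∃ N, HaltsWithMultiplications (a : ℤ) (fun i => (blockWeight u b i : ℤ)) G N ∧
      a * N ≤ (if u < H then (B + m * H + u * (ℓ - m)) ^ 2 else 0) *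
        ∑ i ∈ Finset.Icc 1 (a * (ℓ + 1)), i ^ 2 := by
  have hsum : ∀ c : ℕ, ∑ ρ : Fin ((ℓ + 1) * a), c * ((ρ : ℕ) + 1) ^ 2
      = c * ∑ i ∈ Finset.Icc 1 (a * (ℓ + 1)), i ^ 2 := fun c => by
    rw [← Finset.mul_sum, Fin.sum_univ_eq_sum_range (fun i => (i + 1) ^ 2), mul_comm (ℓ + 1) a,
      Finset.range_eq_Ico, Finset.sum_Ico_add' (fun i => i ^ 2) 0 _ 1, zero_add]
    rfl
  split_ifs with hu
  · rw [← hsum]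
    rcases Nat.lt_or_ge a 2 with h2 | h2
    · obtain rfl : a = 1 := by omega
      obtain ⟨N, hN, hle⟩ := h.halts_of_eq_one (fun j => hb₀ j (by omega)) hml hd hu
      refine ⟨N, by simpa using hN, ?_⟩
      rw [one_mul]
      refine hle.trans (Finset.sum_le_sum fun ρ _ => ?_)
      gcongr
      omega
    · exact h.halts_of_two_le h2 hb hB hml hd hu
  · exact ⟨0, h.halts_zero ha hb (not_lt.mp hu), by simp⟩

end WeightedBlocks

end OnePointAG.AlgorithmG

/-! ### The theorem. -/

open OnePointAG OnePointAG.AlgorithmG OnePointAG.OnePointData in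
theorem mainTheorem4
    {K F : Type*} [Field K] [Finite K] [Field F] [Algebra K F]
    (hF : OnePointAG.IsFunctionField K F)
    (g : ℕ) (hg : OnePointAG.IsGenus K F g)
    (S : OnePointAG.OnePointData K F)
    (u m ℓ : ℕ) (hmℓ : m ≤ ℓ)
    -- the received word and an interpolating function of pole order at most `n + 2g - 1`
    (r : Fin S.n → K) (h : F)
    (h_mem : h ∈ OnePointAG.riemannRochSpace
      (Finsupp.single S.Q ((S.n : ℤ) + 2 * (g : ℤ) - 1) : OnePointAG.Divisor K F))
    (h_interp : ∀ i, 0 < (S.P i).v (h - algebraMap K F (r i)))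
    -- a function in `L(∞Q)` with zero divisor `D`, and the choice of `x_1` with `f ∈ K[x_1]`
    (f : F) (hf : f ∈ OnePointAG.regularAwayFrom S.Q)
    (hfD : OnePointAG.IsZeroDivisor f S.D)
    (hfx : f ∈ Algebra.adjoin K {S.x₁}) :
    ∃ N : ℕ,
      OnePointAG.AlgorithmG.HaltsWithMultiplications
        (-(S.Q.ord S.x₁)) (S.basisWeight u ℓ) (S.generatorVectors f h m ℓ) N ∧
      (N : ℝ) ≤
        ((⨆ j : Fin S.a₁, ((-(S.Q.ord (S.y j)) : ℤ) : ℝ))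
            + (m : ℝ) * ((S.n : ℝ) + 2 * (g : ℝ) - 1) + (u : ℝ) * ((ℓ : ℝ) - (m : ℝ))) ^ 2
          * (S.a₁ : ℝ)⁻¹
          * ∑ i ∈ Finset.Icc 1 (S.a₁ * (ℓ + 1)), (i : ℝ) ^ 2 := by
  have ha : 0 < S.a₁ := S.a_pos 0
  rw [Algebra.adjoin_singleton_eq_range_aeval] at hfx
  obtain ⟨p, rfl⟩ := hfx
  have hp : p ≠ 0 := fun h0 => hfD.1 (by simp [h0])
  have hpn : S.a₁ * p.natDegree ≤ S.n := by
    have h1 := hg.neg_ord_le S.degree_Q S.P S.P_injective S.P_ne_Q S.degree_P hf hfD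
    have h2 : S.Q.ord (Polynomial.aeval S.x₁ p) = -(S.a₁ * p.natDegree : ℤ) := by
      rw [S.Q.ord_eq_iff (aeval_x₁_ne_zero hp), v_aeval_x₁ hp]
    have h3 : -S.Q.ord (Polynomial.aeval S.x₁ p) ≤ S.n := h1
    rw [h2, neg_neg] at h3
    exact_mod_cast h3
  rw [mem_riemannRochSpace_single] at h_mem
  obtain ⟨hh, hhQ⟩ := h_mem
  set H : ℕ := S.n + 2 * g - 1 with hH
  have hHv : ((-(H : ℤ) : ℤ) : WithTop ℤ) ≤ S.Q.v h := by
    -- If `n = g = 0`, truncation gives `H = 0` in place of `-1`; this does no harm because `h` then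
    -- vanishes at `Q` and is zero.
    rcases Nat.eq_zero_or_pos (S.n + 2 * g) with h0 | h0
    · have hpos : 0 < S.Q.v h := by
        refine lt_of_lt_of_le ?_ hhQ
        rw [← WithTop.coe_zero, WithTop.coe_lt_coe]
        omega
      rw [hg.eq_zero_of_v_pos S.degree_Q hh hpos, S.Q.v.map_zero]
      exact le_top
    · convert hhQ using 2
      omega
  have hin : InputWeights S.a₁ ℓ m H p.natDegree S.b
      (S.generatorVectors (Polynomial.aeval S.x₁ p) h m ℓ) :=
    { lower := fun _ _ hr => generatorVectors_of_lt hg hr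
      diag_ne := fun r => by rw [generatorVectors_self hg]; exact pow_ne_zero _ hp
      diag_deg := fun r => by rw [generatorVectors_self hg, Polynomial.natDegree_pow]
      weight_le := fun _ _ hr => generatorVectors_weight_le hg hp hh hHv hr }
  obtain ⟨N, hN, hle⟩ := hin.exists_halts (u := u) (B := Finset.univ.sup S.b) ha
    (fun j => (b_mem hg j).2) (fun j hj => S.b_eq_zero hj) (fun j => Finset.le_sup (Finset.mem_univ j))
    hmℓ (by omega)
  have hux : -(S.Q.ord S.x₁) = (S.a₁ : ℤ) := by rw [S.ord_x, neg_neg]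
  have hw : S.basisWeight u ℓ = fun i => (blockWeight u S.b i : ℤ) := by
    funext i
    rw [basisWeight, ord_y hg, neg_neg, blockWeight]
    push_cast
    rfl
  refine ⟨N, by rw [hux, hw]; exact hN, ?_⟩
  have ha' : (0 : ℝ) < S.a₁ := by exact_mod_cast ha
  have hsum : (0 : ℝ) ≤ ∑ i ∈ Finset.Icc 1 (S.a₁ * (ℓ + 1)), (i : ℝ) ^ 2 := by positivity
  rw [mul_right_comm, ← div_eq_mul_inv, le_div_iff₀ ha', mul_comm (N : ℝ)]
  have hle' : ((S.a₁ * N : ℕ) : ℝ) ≤ _ := Nat.cast_le.mpr hle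
  rw [Nat.cast_mul, Nat.cast_mul, Nat.cast_sum] at hle'
  simp only [Nat.cast_pow] at hle'
  refine hle'.trans (mul_le_mul_of_nonneg_right ?_ hsum)
  -- `u < H` rules out truncation in `H`. Otherwise the count is bounded by zero, and the real bound
  -- is nonnegative as a square, whatever its base.
  split_ifs with hu
  · have hB : ((Finset.univ.sup S.b : ℕ) : ℝ) ≤ ⨆ j : Fin S.a₁, ((-(S.Q.ord (S.y j)) : ℤ) : ℝ) := by
      obtain ⟨j, -, hj⟩ := Finset.exists_mem_eq_sup Finset.univ ⟨⟨0, ha⟩, Finset.mem_univ _⟩ S.b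
      refine le_trans (le_of_eq ?_) (le_ciSup (Set.finite_range _).bddAbove j)
      rw [hj, ord_y hg, neg_neg]
      rfl
    have hHr : (H : ℝ) = (S.n : ℝ) + 2 * (g : ℝ) - 1 := by
      rw [hH, Nat.cast_sub (by omega)]
      push_cast
      ring
    push_cast [Nat.cast_sub hmℓ]
    have h0 : (0 : ℝ) ≤ (ℓ : ℝ) - m := by
      rw [sub_nonneg]; exact_mod_cast hmℓ
    rw [← hHr]
    gcongr
    simpa using hB
  · rw [Nat.cast_zero]
    positivity
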